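/- Let $G=(V,E)$ be a finite simple undirected graph. A triangle-free 2-matching of $G$ is a set $M\subseteq E$ such that every node is incident to at most two edges of $M$ and the graph $(V,M)$ contains no triangle. A trail is a sequence of distinct consecutive edges $u_1u_2,u_2u_3,\dots,u_{k-1}u_k$ of $G$ (nodes may repeat); its length is its number of edges. It is alternating with respect to $M$ if no two consecutive edges both belong to $M$ or both belong to $E\setminus M$. An alternating trail $P$ is augmenting for $M$ if the symmetric difference $M\triangle P$ is a triangle-free 2-matching with $|M|+1$ edges. For $\varepsilon\in(0,1]$ consider the following local search: start with $M=\emptyset$; as long as there is an augmenting trail $P$ for $M$ with at most $2/\varepsilon$ edges, replace $M$ by $M\triangle P$; when there is none, return $M$. Theorem. There is a PTAS for maximum-cardinality triangle-free 2-matching, given by this local search. Precisely: (1) For every real $\varepsilon\in(0,1]$ and every $G$, every execution of the local search (whichever trails are chosen) makes at most $|V|$ flips, and every set $M$ it returns is a triangle-free 2-matching with $|M|\ge(1-\varepsilon)|\mathrm{OPT}|$, where $\mathrm{OPT}$ is a maximum-cardinality triangle-free 2-matching of $G$. (2) There are a program $A$ for a random access machine (unit-cost instructions; addition and truncated subtraction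 of natural numbers, comparison, direct and indirect memory access) and a constant $C$ such that, for every graph $G$ on $n$ nodes, given by any list of its edges, and every rational $\varepsilon=p/q\in(0,1]$, given by the positive integers $p,q$, the program $A$ halts on this input after at most $\max(n,2)^{C/\varepsilon}$ steps and outputs a set that is the result of an execution of the local search; in particular, the output is a triangle-free 2-matching of $G$ with at least $(1-\varepsilon)|\mathrm{OPT}|$ edges. -/

import Mathlib

open scoped symmDiff

namespace TriangleFree

section Graph

variable {V : Type*} [DecidableEq V]

/-- `M` is a triangle-free (simple) 2-matching of `G`: a set of edges of `G`, at most two of them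
incident to each node, such that the graph `(V, M)` contains no triangle. -/
def IsTwoMatching (G : SimpleGraph V) (M : Finset (Sym2 V)) : Prop :=
  (∀ e ∈ M, e ∈ G.edgeSet) ∧
  (∀ v : V, (M.filter (fun e => v ∈ e)).card ≤ 2) ∧
  (SimpleGraph.fromEdgeSet (M : Set (Sym2 V))).CliqueFree 3

/-- The walk `w` is an augmenting trail for `M`: its edges are distinct, any two consecutive edges
are one in `M` and one outside `M`, and the symmetric difference of `M` with its edge set is a
triangle-free 2-matching with exactly one edge more than `M`. -/
def IsAugmentingTrail (G : SimpleGraph V) (M : Finset (Sym2 V)) {u v : V} (w : G.Walk u v) :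
    Prop :=
  w.IsTrail ∧
  w.edges.IsChain (fun e f => (e ∈ M ∧ f ∉ M) ∨ (e ∉ M ∧ f ∈ M)) ∧
  IsTwoMatching G (M ∆ w.edges.toFinset) ∧
  (M ∆ w.edges.toFinset).card = M.card + 1

/-- `Flip G L M M'`: flipping some augmenting trail for `M` with at most `L` edges gives `M'`. -/
def Flip (G : SimpleGraph V) (L : ℝ) (M M' : Finset (Sym2 V)) : Prop :=
  ∃ (u v : V) (w : G.Walk u v),
    IsAugmentingTrail G M w ∧ (w.length : ℝ) ≤ L ∧ M' = M ∆ w.edges.toFinset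

/-- `Run G L k M`: the local search that starts with the empty set and flips augmenting trails with
at most `L` edges (chosen arbitrarily) can hold the set `M` after exactly `k` flips. -/
inductive Run (G : SimpleGraph V) (L : ℝ) : ℕ → Finset (Sym2 V) → Prop
  | start : Run G L 0 ∅
  | flip {k : ℕ} {M M' : Finset (Sym2 V)} : Run G L k M → Flip G L M M' → Run G L (k + 1) M'

/-- `M` is returned by some execution of the local search: it is reached from the empty set, and
there is no augmenting trail for `M` with at most `L` edges. -/
def IsLocalSearchResult (G : SimpleGraph V) (L : ℝ) (M : Finset (Sym2 V)) : Prop :=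
  (∃ k, Run G L k M) ∧ ∀ M', ¬ Flip G L M M'

end Graph

/-! ### Random access machine

A random access machine with structured control flow. It has registers and finitely many (in any
given program) arrays, all of whose cells hold natural numbers. Every elementary instruction and
every evaluation of a test takes one step. The only arithmetic is addition and truncated
subtraction, so numbers gain at most one bit per step. -/

/-- A memory state: the contents of the registers and of the arrays. -/
@[ext] structure State where
  reg : ℕ → ℕ
  arr : ℕ → ℕ → ℕ

/-- Write a value into a register. -/
def State.setReg (s : State) (r x : ℕ) : State :=
  { s with reg := Function.update s.reg r x }

/-- Write a value into cell `i` of array `k`. -/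
def State.setArr (s : State) (k i x : ℕ) : State :=
  { s with arr := Function.update s.arr k (Function.update (s.arr k) i x) }

/-- Programs. Registers, arrays and constants are fixed by the program text; only `load` and
`store` address an array cell through the contents of a register. -/
inductive Program
  /-- do nothing -/
  | skip : Program
  /-- `const r c`: register `r` becomes `c` -/
  | const (r c : ℕ) : Program
  /-- `copy r a`: register `r` becomes the contents of register `a` -/
  | copy (r a : ℕ) : Program
  /-- `add r a b`: register `r` becomes the sum of registers `a` and `b` -/
  | add (r a b : ℕ) : Program
  /-- `sub r a b`: register `r` becomes the truncated difference of registers `a` and `b` -/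
  | sub (r a b : ℕ) : Program
  /-- `load r k a`: register `r` becomes the cell of array `k` whose index is in register `a` -/
  | load (r k a : ℕ) : Program
  /-- `store k a b`: the cell of array `k` whose index is in register `a` becomes the contents of
  register `b` -/
  | store (k a b : ℕ) : Program
  /-- sequential composition -/
  | seq (P Q : Program) : Program
  /-- `ifLt a b P Q`: if register `a` is less than register `b` then `P` else `Q` -/
  | ifLt (a b : ℕ) (P Q : Program) : Program
  /-- `whileLt a b P`: as long as register `a` is less than register `b`, do `P` -/
  | whileLt (a b : ℕ) (P : Program) : Program

/-- `Exec P s s' t`: started in state `s`, the program `P` halts in state `s'` after exactly `t`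
steps. -/
inductive Exec : Program → State → State → ℕ → Prop
  | skip (s) : Exec .skip s s 1
  | const (r c s) : Exec (.const r c) s (s.setReg r c) 1
  | copy (r a s) : Exec (.copy r a) s (s.setReg r (s.reg a)) 1
  | add (r a b s) : Exec (.add r a b) s (s.setReg r (s.reg a + s.reg b)) 1
  | sub (r a b s) : Exec (.sub r a b) s (s.setReg r (s.reg a - s.reg b)) 1
  | load (r k a s) : Exec (.load r k a) s (s.setReg r (s.arr k (s.reg a))) 1
  | store (k a b s) : Exec (.store k a b) s (s.setArr k (s.reg a) (s.reg b)) 1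
  | seq {P Q s₁ s₂ s₃ t₁ t₂} :
      Exec P s₁ s₂ t₁ → Exec Q s₂ s₃ t₂ → Exec (.seq P Q) s₁ s₃ (t₁ + t₂)
  | ifTrue {a b P Q s s' t} :
      s.reg a < s.reg b → Exec P s s' t → Exec (.ifLt a b P Q) s s' (t + 1)
  | ifFalse {a b P Q s s' t} :
      ¬ s.reg a < s.reg b → Exec Q s s' t → Exec (.ifLt a b P Q) s s' (t + 1)
  | whileTrue {a b P s₁ s₂ s₃ t₁ t₂} :
      s₁.reg a < s₁.reg b → Exec P s₁ s₂ t₁ → Exec (.whileLt a b P) s₂ s₃ t₂ →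
      Exec (.whileLt a b P) s₁ s₃ (t₁ + t₂ + 1)
  | whileFalse {a b P s} :
      ¬ s.reg a < s.reg b → Exec (.whileLt a b P) s s 1

/-- Programs are deterministic: the final state and the number of steps are unique. -/
theorem Exec.deterministic {P : Program} {s s₁ s₂ : State} {t₁ t₂ : ℕ}
    (h₁ : Exec P s s₁ t₁) (h₂ : Exec P s s₂ t₂) : s₁ = s₂ ∧ t₁ = t₂ := by
  induction h₁ generalizing s₂ t₂ with
  | seq _ _ ih₁ ih₂ =>
    cases h₂ with
    | seq k₁ k₂ =>
      obtain ⟨rfl, rfl⟩ := ih₁ k₁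
      obtain ⟨rfl, rfl⟩ := ih₂ k₂
      exact ⟨rfl, rfl⟩
  | ifTrue h _ ih =>
    cases h₂ with
    | ifTrue _ k => obtain ⟨rfl, rfl⟩ := ih k; exact ⟨rfl, rfl⟩
    | ifFalse h' _ => exact absurd h h'
  | ifFalse h _ ih =>
    cases h₂ with
    | ifTrue h' _ => exact absurd h' h
    | ifFalse _ k => obtain ⟨rfl, rfl⟩ := ih k; exact ⟨rfl, rfl⟩
  | whileTrue h _ _ ih₁ ih₂ =>
    cases h₂ with
    | whileTrue _ k₁ k₂ =>
      obtain ⟨rfl, rfl⟩ := ih₁ k₁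
      obtain ⟨rfl, rfl⟩ := ih₂ k₂
      exact ⟨rfl, rfl⟩
    | whileFalse h' => exact absurd h h'
  | whileFalse h =>
    cases h₂ with
    | whileTrue h' _ _ => exact absurd h' h
    | whileFalse _ => exact ⟨rfl, rfl⟩
  | _ => cases h₂; exact ⟨rfl, rfl⟩

/-! ### Input and output -/

/-- `l` lists every edge of `G` exactly once, each as a pair of its endpoints, in any order. -/
def IsEdgeList {n : ℕ} (G : SimpleGraph (Fin n)) (l : List (Fin n × Fin n)) : Prop :=
  (l.map (fun x => s(x.1, x.2))).Nodup ∧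
  ∀ e : Sym2 (Fin n), e ∈ l.map (fun x => s(x.1, x.2)) ↔ e ∈ G.edgeSet

/-- The initial memory. Registers 0, 1, 2, 3 hold the number of nodes, the number of edges, and the
numerator `p` and denominator `q` of `ε = p / q`. Cell `i` of array 0 and cell `i` of array 1 hold
the two endpoints of the `i`-th edge. Everything else is zero. -/
def inputState {n : ℕ} (l : List (Fin n × Fin n)) (p q : ℕ) : State where
  reg := fun r =>
    if r = 0 then n else if r = 1 then l.length else if r = 2 then p else if r = 3 then q else 0
  arr := fun k i =>
    if h : i < l.length then
      if k = 0 then ((l[i]).1 : ℕ) else if k = 1 then ((l[i]).2 : ℕ) else 0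
    else 0

/-- The edge set returned in the final state `s`: the `i`-th edge belongs to it exactly if cell `i`
of array 2 is not zero. -/
def outputEdges {n : ℕ} (l : List (Fin n × Fin n)) (s : State) : Finset (Sym2 (Fin n)) :=
  (Finset.univ.filter (fun i : Fin l.length => s.arr 2 i ≠ 0)).image
    (fun i => s((l[i]).1, (l[i]).2))

end TriangleFree

/-! Let `M` be the result of the local search and `O` a larger triangle-free 2-matching. For plain
2-matchings one would pair, at every node, edges of `M \ O` with edges of `O \ M` as long as
possible. This splits `M ∆ O` into alternating trails and cycles, each of which can be flipped
alone. Triangles are the obstacle: a flip may create a triangle out of kept edges of `M` and new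
edges of `O`. Such a triangle has a corner formed by a kept edge of `M \ O` and a new edge of `O \
M`. If some corner of that kind in the triangle is paired, its two edges are flipped together or not
at all, and the triangle cannot arise (`isTwoMatching_symmDiff`).

So a pairing is needed that hits every mixed triangle of `M ∪ O` in a corner. If the third edge lies
in both sets there is only one candidate corner, otherwise there are two. Corners at one node
conflict if they share exactly one edge. A corner without conflicts is pure and is always taken.
When both corners of a triangle are impure, an arbitrary injective labelling of the nodes decides
between them, so that two triangles on a common edge are served at different ends of it. That the
choices never conflict (`Selected.compat`) needs some local configurations to be absent. These are
configurations where `O` can trade two edges outside `M` for two edges of `M` by reversing a segment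
of length one or two. Taking `O` of the given size with the largest overlap with `M` excludes them
(`exists_noExchange`).

It remains to count. Start from an edge of `O \ M` that is unpaired at one end and follow the
pairing: the thread repeats no edge and stops. It gains nothing, or it gains one edge and is an
augmenting trail. If no augmenting trail has at most `2K - 1` edges, every gain of one uses at least
`K + 1` edges of `O \ M`, hence `(K + 1)(|O| - |M|) ≤ |O|` (`exists_augmentingTrail`). With `K =
⌊1/ε⌋` this gives the approximation ratio. Every flip adds an edge and a 2-matching has at most
`|V|` edges, which bounds the number of flips.

For the running time, a trail with at most `L = ⌊2q/p⌋` edges is a list of darts, coded by a number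
below `(2m + 1) ^ L`, where `m` is the number of edges. The program makes `n + 1` passes over all
codes, testing and flipping. A pass without a flip certifies local optimality, and `n + 1` passes
cannot all contain a flip. Correctness and time are proved together with the predicate `Ends`, by
loop invariants, and `Darts.Represents.flip_iff` translates between dart lists and walks. -/

namespace TriangleFree

/-! ### Corners of mixed triangles and a conflict-free selection -/

section Corners

variable {V : Type*}

/-- A symmetric, irreflexive, triangle-free relation of maximum degree two. -/
structure TwoRel (m : V → V → Prop) : Prop where
  symm : ∀ {x y}, m x y → m y x
  irrefl : ∀ x, ¬ m x x
  deg : ∀ {v x y z}, m v x → m v y → m v z → x = y ∨ y = z ∨ x = z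
  tri : ∀ {x y z}, m x y → m y z → m x z → False

/-- The edges `va` of `m \ o` and `vb` of `o \ m` span a triangle of `m ∪ o`. -/
def Corner (m o : V → V → Prop) (v a b : V) : Prop :=
  m v a ∧ ¬ o v a ∧ o v b ∧ ¬ m v b ∧ (m a b ∨ o a b)

/-- No other corner at `v` shares exactly one edge with the corner `(v, a, b)`. -/
def PureCorner (m o : V → V → Prop) (v a b : V) : Prop :=
  ∀ a' b', Corner m o v a' b' → (a = a' ↔ b = b')

/-- The corners that are selected to be paired. -/
def Selected (f : V → ℕ) (m o : V → V → Prop) (v a b : V) : Prop :=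
  Corner m o v a b ∧
  (PureCorner m o v a b ∨ (m a b ∧ o a b) ∨
    (m a b ∧ ¬ o a b ∧ ¬ PureCorner m o b a v ∧
      (f v < f b ↔ ∀ a', m v a' → ¬ o v a' → m b a' → ¬ o b a' → f a ≤ f a')) ∨
    (o a b ∧ ¬ m a b ∧ ¬ PureCorner m o a v b ∧
      (f v < f a ↔ ∀ b', o v b' → ¬ m v b' → o a b' → ¬ m a b' → f b ≤ f b')))

/-- No exchange of two edges of `o` by two edges of `m` that reverses a segment of at most two
edges is possible. -/
structure NoExchange (m o : V → V → Prop) : Prop where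
  short : ∀ {w x y z}, o w x → ¬ m w x → o x y → o y z → ¬ m y z →
    m w y → ¬ o w y → m x z → ¬ o x z → False
  long : ∀ {w x t y z}, o w x → ¬ m w x → o x t → o t y → o y z → ¬ m y z →
    m w y → ¬ o w y → m x z → ¬ o x z → w ≠ z → False

variable {m o : V → V → Prop}

/-- Two triangles share the `m`-edge `va`; one has its third edge in `m`, the other in `o` only. The
second triangle then has an alternative corner at `a`, and a conflict there would produce an
exchange. Hence that alternative is always available and the corner at `v` need not be selected. -/
theorem pureCorner_of_mixed_left (hm : TwoRel m) (ho : TwoRel o) (hx : NoExchange m o)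
    {v a b₁ b₂ : V} (hb : b₁ ≠ b₂) (h₁ : Corner m o v a b₁) (h₂ : Corner m o v a b₂)
    (h₁' : m a b₁) (h₂' : ¬ m a b₂) : PureCorner m o a v b₂ := by
  obtain ⟨va, va', vb, vb', ab⟩ := h₁
  obtain ⟨-, -, vc, vc', ac⟩ := h₂
  have ac : o a b₂ := by tauto
  rintro d g ⟨ad, ad', ag, ag', dg⟩
  have vne : v ≠ b₁ := by rintro rfl; exact ho.irrefl _ vb
  -- If `ab₁` belongs to both relations, the degree bounds leave one edge of `m \ o` and one of `o \
  -- m` at `a`, hence a single corner.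
  by_cases hab : o a b₁
  · have := ho.deg hab ac ag
    have := hm.deg h₁' (hm.symm va) ad
    grind
  · constructor
    · rintro rfl
      by_contra hne
      rcases em (o v g) with h | h
      · have := ho.deg vb vc h
        grind
      · have hvg : m v g := by tauto
        exact hx.long (ho.symm vb) (fun h => vb' (hm.symm h)) vc (ho.symm ac) ag ag'
          (hm.symm h₁') (fun h => hab (ho.symm h)) hvg h (by rintro rfl; exact vb' hvg)
    · rintro rfl
      by_contra hne
      have hd := hm.deg (hm.symm va) h₁' ad
      have : d = b₁ := by grind
      subst this
      rcases em (o d b₂) with h | h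
      · exact ho.tri vb h vc
      · have hm' : m d b₂ := by tauto
        exact hx.short (ho.symm vb) (fun h => vb' (hm.symm h)) vc (ho.symm ac)
          (fun h => h₂' (hm.symm h)) hm' h va va'

/-- The mirror image, with a shared `o`-edge. `NoExchange` is not symmetric in `m` and `o`, so the
argument is separate; here reversing a single edge suffices. -/
theorem pureCorner_of_mixed_right (hm : TwoRel m) (ho : TwoRel o) (hx : NoExchange m o)
    {v a₁ a₂ b : V} (ha : a₁ ≠ a₂) (h₁ : Corner m o v a₁ b) (h₂ : Corner m o v a₂ b)
    (h₁' : o a₁ b) (h₂' : ¬ o a₂ b) : PureCorner m o b a₂ v := by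
  obtain ⟨va, va', vb, vb', ab⟩ := h₁
  obtain ⟨vc, vc', -, -, cb⟩ := h₂
  have cb : m a₂ b := by tauto
  have hne₁ : v ≠ a₁ := by rintro rfl; exact hm.irrefl _ va
  rintro d g ⟨bd, bd', bg, bg', dg⟩
  by_cases hab : m a₁ b
  · have := ho.deg (ho.symm h₁') (ho.symm vb) bg
    have := hm.deg (hm.symm hab) (hm.symm cb) bd
    have := hm.symm hab
    have := ho.symm h₁'
    grind
  · constructor
    · rintro rfl
      by_contra hne
      have := ho.deg (ho.symm vb) (ho.symm h₁') bg
      have : g = a₁ := by grind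
      subst this
      rcases em (m a₂ g) with h | h
      · exact hm.tri va (hm.symm h) vc
      · exact hx.short (by tauto) h h₁' (ho.symm vb) (fun h => vb' (hm.symm h))
          cb h₂' (hm.symm va) (fun h => va' (ho.symm h))
    · rintro rfl
      by_contra hne
      rcases em (m d v) with h | h
      · have := hm.deg va vc (hm.symm h)
        have := hm.symm bd
        grind
      · exact hx.short h₁' hab (ho.symm vb) (y := v) (z := d) (ho.symm (by tauto))
          (fun h' => h (hm.symm h')) (hm.symm va) (fun h => va' (ho.symm h)) bd bd'

/-- Exactly one of two distinctly labelled candidates is the smaller one, so "being the smallest"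
cannot have the same truth value for both. -/
theorem false_of_tie {f : V → ℕ} (hf : f.Injective) {p : Prop} {P : V → Prop} {b b' : V}
    (hne : b ≠ b') (hb : P b) (hb' : P b') (hP : ∀ x, P x → b = x ∨ b' = x)
    (h : p ↔ ∀ x, P x → f b ≤ f x) (h' : p ↔ ∀ x, P x → f b' ≤ f x) : False := by
  have hfb := hf.ne hne
  by_cases hp : p
  · have := h.1 hp _ hb'
    have := h'.1 hp _ hb
    omega
  · simp only [hp, false_iff, not_forall] at h h'
    obtain ⟨x, hx, h⟩ := h
    obtain ⟨y, hy, h'⟩ := h'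
    rcases hP x hx with rfl | rfl <;> rcases hP y hy with rfl | rfl <;> omega

theorem Selected.tie_left {f : V → ℕ} {v a b : V} (h : Selected f m o v a b)
    (hp : ¬ PureCorner m o v a b) (hab : ¬ m a b) :
    f v < f a ↔ ∀ x, (o v x ∧ ¬ m v x ∧ o a x ∧ ¬ m a x) → f b ≤ f x := by
  rcases h.2 with h | h | h | h
  · exact absurd h hp
  · exact absurd h.1 hab
  · exact absurd h.1 hab
  · simpa only [and_imp] using h.2.2.2

theorem Selected.tie_right {f : V → ℕ} {v a b : V} (h : Selected f m o v a b)
    (hp : ¬ PureCorner m o v a b) (hab : ¬ o a b) :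
    f v < f b ↔ ∀ x, (m v x ∧ ¬ o v x ∧ m b x ∧ ¬ o b x) → f a ≤ f x := by
  rcases h.2 with h | h | h | h
  · exact absurd h hp
  · exact absurd h.2 hab
  · simpa only [and_imp] using h.2.2.2
  · exact absurd h.1 hab

/-- Two conflicting selected corners are both impure. If the third edges of their triangles lie in
different sets, the mixed lemmas make the alternative corner of one triangle pure, which forbids
selecting its corner at `v`. If both third edges lie in the set of the shared edge, a node has
degree three. Otherwise both triangles have the same two candidate nodes, and the tie-breaking rule
gives only one of them to `v`. -/
theorem Selected.compat {f : V → ℕ} (hf : f.Injective) (hm : TwoRel m) (ho : TwoRel o)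
    (hx : NoExchange m o) {v a b a' b' : V} (h : Selected f m o v a b)
    (h' : Selected f m o v a' b') : a = a' ↔ b = b' := by
  by_contra hne
  have hp : ¬ PureCorner m o v a b := fun hp => hne (hp _ _ h'.1)
  have hp' : ¬ PureCorner m o v a' b' := fun hp => hne (by
    have := hp _ _ h.1
    grind)
  have hs := h
  have hs' := h'
  obtain ⟨hc, h⟩ := h
  obtain ⟨hc', h'⟩ := h'
  have va := hc.1
  have va' := hc'.1
  have vb := hc.2.2.1
  have vb' := hc'.2.2.1
  rcases em (a = a') with rfl | hna
  · have hnb : b ≠ b' := fun h => hne (by simp [h])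
    have hL := pureCorner_of_mixed_left hm ho hx hnb hc hc'
    have hL' := pureCorner_of_mixed_left hm ho hx hnb.symm hc' hc
    rcases em (m a b) with hab | hab
    · rcases em (m a b') with hab' | hab'
      · have := hm.deg (hm.symm va) hab hab'
        have : v ≠ b := by rintro rfl; exact ho.irrefl _ vb
        have : v ≠ b' := by rintro rfl; exact ho.irrefl _ vb'
        grind
      · rcases h' with h | h | h | h
        exacts [hp' h, hab' h.1, hab' h.1, h.2.2.1 (hL hab hab')]
    · rcases em (m a b') with hab' | hab'
      · rcases h with h | h | h | h
        exacts [hp h, hab h.1, hab h.1, h.2.2.1 (hL' hab' hab)]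
      · have ab := hc.2.2.2.2
        have ab' := hc'.2.2.2.2
        refine false_of_tie hf (p := f v < f a)
          (P := fun x => o v x ∧ ¬ m v x ∧ o a x ∧ ¬ m a x) hnb ⟨vb, hc.2.2.2.1, ab.resolve_left hab, hab⟩
          ⟨vb', hc'.2.2.2.1, ab'.resolve_left hab', hab'⟩ (fun x hx => ?_)
          (hs.tie_left hp hab) (hs'.tie_left hp' hab')
        exact (ho.deg vb vb' hx.1).elim (absurd · hnb) Or.symm
  · have hnb : b = b' := by
      by_contra h
      exact hne (by simp [hna, h])
    subst hnb
    have hL := pureCorner_of_mixed_right hm ho hx hna hc hc'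
    have hL' := pureCorner_of_mixed_right hm ho hx (Ne.symm hna) hc' hc
    rcases em (o a b) with hab | hab
    · rcases em (o a' b) with hab' | hab'
      · have := ho.deg (ho.symm vb) (ho.symm hab) (ho.symm hab')
        have : v ≠ a := by rintro rfl; exact hm.irrefl _ va
        have : v ≠ a' := by rintro rfl; exact hm.irrefl _ va'
        grind
      · rcases h' with h | h | h | h
        exacts [hp' h, hab' h.2, h.2.2.1 (hL hab hab'), hab' h.1]
    · rcases em (o a' b) with hab' | hab'
      · rcases h with h | h | h | h
        exacts [hp h, hab h.2, h.2.2.1 (hL' hab' hab), hab h.1]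
      · have ab := hc.2.2.2.2
        have ab' := hc'.2.2.2.2
        have ba := hm.symm (ab.resolve_right hab)
        have ba' := hm.symm (ab'.resolve_right hab')
        refine false_of_tie hf (p := f v < f b)
          (P := fun x => m v x ∧ ¬ o v x ∧ m b x ∧ ¬ o b x) hna
          ⟨va, hc.2.1, ba, fun h => hab (ho.symm h)⟩
          ⟨va', hc'.2.1, ba', fun h => hab' (ho.symm h)⟩ (fun x hx => ?_)
          (hs.tie_right hp hab) (hs'.tie_right hp' hab')
        exact (hm.deg va va' hx.1).elim (absurd · hna) Or.symm

/-- This is where every mixed triangle gets hit. If both of its corners are impure, the tie-breaking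
conditions at the two nodes have the same right-hand side and opposite comparisons on the left, so
one of them holds. -/
theorem Corner.selected_or {f : V → ℕ} (hf : f.Injective) (hm : TwoRel m) (ho : TwoRel o) {v a b : V}
    (h : Corner m o v a b) : Selected f m o v a b ∨
      (m a b ∧ ¬ o a b ∧ Selected f m o b a v) ∨ (o a b ∧ ¬ m a b ∧ Selected f m o a v b) := by
  have h' := h
  obtain ⟨va, va', vb, vb', ab⟩ := h'
  by_cases hp : PureCorner m o v a b
  · exact .inl ⟨h, .inl hp⟩
  rcases em (m a b) with hab | hab <;> rcases em (o a b) with hab' | hab'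
  · exact .inl ⟨h, .inr (.inl ⟨hab, hab'⟩)⟩
  · have hc : Corner m o b a v := ⟨hm.symm hab, fun h => hab' (ho.symm h), ho.symm vb,
      fun h => vb' (hm.symm h), .inl (hm.symm va)⟩
    by_cases hq : PureCorner m o b a v
    · exact .inr (.inl ⟨hab, hab', hc, .inl hq⟩)
    by_cases ht : (f v < f b ↔ ∀ a', m v a' → ¬ o v a' → m b a' → ¬ o b a' → f a ≤ f a')
    · exact .inl ⟨h, .inr (.inr (.inl ⟨hab, hab', hq, ht⟩))⟩
    · refine .inr (.inl ⟨hab, hab', hc, .inr (.inr (.inl ⟨hm.symm va, fun h => va' (ho.symm h),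
        hp, ?_⟩))⟩)
      have : f v ≠ f b := fun h => ho.irrefl v (by simpa [hf h] using vb)
      grind
  · have hc : Corner m o a v b := ⟨hm.symm va, fun h => va' (ho.symm h), hab', hab, .inr vb⟩
    by_cases hq : PureCorner m o a v b
    · exact .inr (.inr ⟨hab', hab, hc, .inl hq⟩)
    by_cases ht : (f v < f a ↔ ∀ b', o v b' → ¬ m v b' → o a b' → ¬ m a b' → f b ≤ f b')
    · exact .inl ⟨h, .inr (.inr (.inr ⟨hab', hab, hq, ht⟩))⟩
    · refine .inr (.inr ⟨hab', hab, hc, .inr (.inr (.inr ⟨vb, vb', hp, ?_⟩))⟩)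
      have : f v ≠ f a := fun h => hm.irrefl v (by simpa [hf h] using va)
      grind
  · tauto

end Corners

/-! ### Exchanges that bring `O` closer to `M` -/

section Exchange

variable {V : Type*}

/-- Adjacency in the graph with edge set `M`. -/
def Rel (M : Finset (Sym2 V)) (x y : V) : Prop := s(x, y) ∈ M

theorem Rel.symm {M : Finset (Sym2 V)} {x y : V} (h : Rel M x y) : Rel M y x := by
  unfold Rel at *
  rwa [Sym2.eq_swap]

theorem rel_comm {M : Finset (Sym2 V)} {x y : V} : Rel M x y ↔ Rel M y x := ⟨.symm, .symm⟩

theorem isTwoMatching_iff [DecidableEq V] {G : SimpleGraph V} {M : Finset (Sym2 V)} :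
    IsTwoMatching G M ↔ (∀ e ∈ M, e ∈ G.edgeSet) ∧ TwoRel (Rel M) := by
  unfold IsTwoMatching
  refine and_congr_right fun hG => ?_
  have hirr : ∀ x, ¬ Rel M x x := fun x hx => by simpa using hG _ hx
  constructor
  · rintro ⟨hd, ht⟩
    refine ⟨fun h => h.symm, hirr, ?_, ?_⟩
    · intro v x y z hx hy hz
      by_contra! hne
      refine absurd (hd v) (not_le.2 ?_)
      rw [Finset.two_lt_card]
      refine ⟨s(v, x), Finset.mem_filter.2 ⟨hx, Sym2.mem_mk_left _ _⟩, s(v, y), Finset.mem_filter.2 ⟨hy, Sym2.mem_mk_left _ _⟩, s(v, z), Finset.mem_filter.2 ⟨hz, Sym2.mem_mk_left _ _⟩,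
        ?_, ?_, ?_⟩ <;> simp <;> grind
    · intro x y z hx hy hz
      have hne : ∀ {a b}, Rel M a b → a ≠ b := fun h e => hirr _ (e ▸ h)
      refine ht {x, y, z} (SimpleGraph.is3Clique_triple_iff.2 ?_)
      simp only [SimpleGraph.fromEdgeSet_adj, Finset.mem_coe]
      exact ⟨⟨hx, hne hx⟩, ⟨hz, hne hz⟩, ⟨hy, hne hy⟩⟩
  · intro h
    refine ⟨fun v => ?_, fun s hs => ?_⟩
    · by_contra! hlt
      rw [Finset.two_lt_card] at hlt
      obtain ⟨a, ha, b, hb, c, hc, hab, hac, hbc⟩ := hlt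
      simp only [Finset.mem_filter] at ha hb hc
      obtain ⟨ha, x, rfl⟩ := ha
      obtain ⟨hb, y, rfl⟩ := hb
      obtain ⟨hc, z, rfl⟩ := hc
      rcases h.deg (show Rel M v x from ha) (show Rel M v y from hb) (show Rel M v z from hc) with
        rfl | rfl | rfl
      exacts [hab rfl, hbc rfl, hac rfl]
    · obtain ⟨a, b, c, hab, hac, hbc, -⟩ := SimpleGraph.is3Clique_iff.1 hs
      simp only [SimpleGraph.fromEdgeSet_adj, Finset.mem_coe] at hab hac hbc
      exact h.tri (show Rel M a b from hab.1) (show Rel M b c from hbc.1)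
        (show Rel M a c from hac.1)

theorem IsTwoMatching.twoRel [DecidableEq V] {G : SimpleGraph V} {M : Finset (Sym2 V)}
    (h : IsTwoMatching G M) : TwoRel (Rel M) := (isTwoMatching_iff.1 h).2

variable [DecidableEq V]

/-- Reversing a segment from `x` to `y` in the path `w, x, …, y, z` of `O`. -/
def exchange (O : Finset (Sym2 V)) (w x y z : V) : Finset (Sym2 V) :=
  (O \ {s(w, x), s(y, z)}) ∪ {s(w, y), s(x, z)}

theorem rel_exchange {O : Finset (Sym2 V)} {w x y z p q : V} :
    Rel (exchange O w x y z) p q ↔ (Rel O p q ∧ ¬ (p = w ∧ q = x) ∧ ¬ (p = x ∧ q = w) ∧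
      ¬ (p = y ∧ q = z) ∧ ¬ (p = z ∧ q = y)) ∨ (p = w ∧ q = y) ∨ (p = y ∧ q = w) ∨
      (p = x ∧ q = z) ∨ (p = z ∧ q = x) := by
  simp only [Rel, exchange, Finset.mem_union, Finset.mem_sdiff, Finset.mem_insert,
    Finset.mem_singleton, Sym2.eq_iff, not_or, or_assoc]

/-- The nodes `s` and `t` are the neighbours of `x` and `y` inside the reversed segment, which has
one edge (`s = y`, `t = x`) or two (`s = t`). A new triangle would contain a new edge `wy` or `xz`.
The only other possible neighbour of `y` is `t`, which is not adjacent to `w`; likewise for `x`, `s`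
and `z`. -/
theorem twoRel_exchange {O : Finset (Sym2 V)} (hO : TwoRel (Rel O)) {w x y z s t : V}
    (hwx : Rel O w x) (hyz : Rel O y z) (hxs : Rel O x s) (hyt : Rel O y t)
    (hwy : ¬ Rel O w y) (hxz : ¬ Rel O x z) (hwz : w ≠ z) (hxy : x ≠ y) (hwy' : w ≠ y)
    (hxz' : x ≠ z) (hst : s = y ∧ t = x ∨ s = t ∧ s ≠ x ∧ s ≠ y) :
    TwoRel (Rel (exchange O w x y z)) := by
  have ne : ∀ {a b}, Rel O a b → a ≠ b := fun h e => hO.irrefl _ (e ▸ h)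
  have hws : w ≠ s := by
    rintro rfl
    grind [Rel.symm]
  have hzt : z ≠ t := by
    rintro rfl
    grind [Rel.symm]
  have hx : ∀ {q}, Rel (exchange O w x y z) x q → q = s ∨ q = z := by
    intro q hq
    rcases rel_exchange.1 hq with h | h | h | h | h
    · have := hO.deg hwx.symm hxs h.1
      grind
    all_goals have := ne hwx; have := ne hyz; grind
  have hy : ∀ {q}, Rel (exchange O w x y z) y q → q = t ∨ q = w := by
    intro q hq
    rcases rel_exchange.1 hq with h | h | h | h | h
    · have := hO.deg hyz hyt h.1
      grind
    all_goals have := ne hwx; have := ne hyz; grind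
  have hws' : ¬ Rel (exchange O w x y z) w t := by
    intro h
    rcases hst with ⟨-, rfl⟩ | ⟨rfl, h1, h2⟩
    · rw [rel_exchange] at h
      grind
    · rw [rel_exchange] at h
      rcases h with h | h
      · have := hO.deg hxs.symm hyt.symm h.1.symm
        grind
      · grind
  have hzs' : ¬ Rel (exchange O w x y z) z s := by
    intro h
    rcases hst with ⟨rfl, -⟩ | ⟨rfl, h1, h2⟩
    · rw [rel_exchange] at h
      grind
    · rw [rel_exchange] at h
      rcases h with h | h
      · have := hO.deg hxs.symm hyt.symm h.1.symm
        grind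
      · grind
  have irr : ∀ p, ¬ Rel (exchange O w x y z) p p := by
    intro p h
    rw [rel_exchange] at h
    have := hO.irrefl p
    grind
  have newl : ∀ {r}, Rel (exchange O w x y z) w r → Rel (exchange O w x y z) y r → False := by
    intro r h1 h2
    rcases hy h2 with rfl | rfl
    exacts [hws' h1, irr _ h1]
  have newr : ∀ {r}, Rel (exchange O w x y z) x r → Rel (exchange O w x y z) z r → False := by
    intro r h1 h2
    rcases hx h1 with rfl | rfl
    exacts [hzs' h2, irr _ h2]
  refine ⟨fun h => h.symm, irr, ?_, ?_⟩
  · intro v a b c ha hb hc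
    -- Degrees do not grow: swapping `x` with `y`, or `w` with `z`, sends the new neighbours of an
    -- affected node injectively to old ones.
    have key : ∃ φ : V → V, φ.Injective ∧ ∀ q, Rel (exchange O w x y z) v q → Rel O v (φ q) := by
      by_cases h1 : v = w ∨ v = z
      · refine ⟨Equiv.swap x y, (Equiv.swap x y).injective, fun q hq => ?_⟩
        have := hyz.symm
        rw [rel_exchange] at hq
        rw [Equiv.swap_apply_def]
        grind
      by_cases h2 : v = x ∨ v = y
      · refine ⟨Equiv.swap w z, (Equiv.swap w z).injective, fun q hq => ?_⟩
        have := hwx.symm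
        rw [rel_exchange] at hq
        rw [Equiv.swap_apply_def]
        grind
      · refine ⟨id, Function.injective_id, fun q hq => ?_⟩
        rw [rel_exchange] at hq
        simp only [id]
        grind
    obtain ⟨φ, hφ, h⟩ := key
    simpa [hφ.eq_iff] using hO.deg (h _ ha) (h _ hb) (h _ hc)
  · intro a b c hab hbc hac
    rcases rel_exchange.1 hab with h1 | ⟨rfl, rfl⟩ | ⟨rfl, rfl⟩ | ⟨rfl, rfl⟩ | ⟨rfl, rfl⟩
    · rcases rel_exchange.1 hbc with h2 | ⟨rfl, rfl⟩ | ⟨rfl, rfl⟩ | ⟨rfl, rfl⟩ | ⟨rfl, rfl⟩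
      · rcases rel_exchange.1 hac with h3 | ⟨rfl, rfl⟩ | ⟨rfl, rfl⟩ | ⟨rfl, rfl⟩ | ⟨rfl, rfl⟩
        · exact hO.tri h1.1 h2.1 h3.1
        · exact newl hab hbc.symm
        · exact newl hbc.symm hab
        · exact newr hab hbc.symm
        · exact newr hbc.symm hab
      · exact newl hab.symm hac.symm
      · exact newl hac.symm hab.symm
      · exact newr hab.symm hac.symm
      · exact newr hac.symm hab.symm
    · exact newl hac hbc
    · exact newl hbc hac
    · exact newr hac hbc
    · exact newr hbc hac

theorem isTwoMatching_exchange {G : SimpleGraph V} {M O : Finset (Sym2 V)}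
    (hM : IsTwoMatching G M) (hO : IsTwoMatching G O) {w x y z s t : V}
    (hwx : Rel O w x) (hyz : Rel O y z) (hxs : Rel O x s) (hyt : Rel O y t)
    (hwy : ¬ Rel O w y) (hxz : ¬ Rel O x z) (hwy' : Rel M w y) (hxz' : Rel M x z)
    (hwx' : ¬ Rel M w x) (hyz' : ¬ Rel M y z)
    (hwz : w ≠ z) (hxy : x ≠ y) (hst : s = y ∧ t = x ∨ s = t ∧ s ≠ x ∧ s ≠ y) :
    IsTwoMatching G (exchange O w x y z) ∧ (exchange O w x y z).card = O.card ∧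
      (O ∩ M).card < (exchange O w x y z ∩ M).card := by
  have hwy'' : w ≠ y := by rintro rfl; exact hM.twoRel.irrefl _ hwy'
  have hxz'' : x ≠ z := by rintro rfl; exact hM.twoRel.irrefl _ hxz'
  have hwx'' : w ≠ x := by rintro rfl; exact hO.twoRel.irrefl _ hwx
  refine ⟨isTwoMatching_iff.2 ⟨?_, twoRel_exchange hO.twoRel hwx hyz hxs hyt hwy hxz hwz hxy
    hwy'' hxz'' hst⟩, ?_, ?_⟩
  · intro e he
    simp only [exchange, Finset.mem_union, Finset.mem_sdiff, Finset.mem_insert,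
      Finset.mem_singleton] at he
    rcases he with he | rfl | rfl
    · exact hO.1 _ he.1
    · exact hM.1 _ hwy'
    · exact hM.1 _ hxz'
  · have h1 : ({s(w, x), s(y, z)} : Finset (Sym2 V)) ⊆ O := by
      intro e he
      simp only [Finset.mem_insert, Finset.mem_singleton] at he
      rcases he with rfl | rfl
      exacts [hwx, hyz]
    have h2 : Disjoint (O \ {s(w, x), s(y, z)}) ({s(w, y), s(x, z)} : Finset (Sym2 V)) := by
      rw [Finset.disjoint_right]
      intro e he
      simp only [Finset.mem_insert, Finset.mem_singleton] at he
      rcases he with rfl | rfl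
      · exact fun h => hwy (Finset.mem_sdiff.1 h).1
      · exact fun h => hxz (Finset.mem_sdiff.1 h).1
    have h3 : ({s(w, x), s(y, z)} : Finset (Sym2 V)).card = 2 :=
      Finset.card_pair (by rw [Ne, Sym2.eq_iff]; tauto)
    have h4 : ({s(w, y), s(x, z)} : Finset (Sym2 V)).card = 2 :=
      Finset.card_pair (by rw [Ne, Sym2.eq_iff]; tauto)
    have := Finset.card_le_card h1
    rw [exchange, Finset.card_union_of_disjoint h2, Finset.card_sdiff_of_subset h1, h3, h4]
    omega
  · apply Finset.card_lt_card
    rw [Finset.ssubset_iff_of_subset]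
    · exact ⟨s(w, y), by simp [exchange]; exact hwy', fun h => hwy (Finset.mem_inter.1 h).1⟩
    · intro e he
      rw [Finset.mem_inter] at he ⊢
      refine ⟨Finset.mem_union_left _ (Finset.mem_sdiff.2 ⟨he.1, ?_⟩), he.2⟩
      simp only [Finset.mem_insert, Finset.mem_singleton]
      rintro (rfl | rfl)
      exacts [hwx' he.2, hyz' he.2]

/-- Among the triangle-free 2-matchings of a given size there is one that admits no exchange
towards `M`. -/
theorem exists_noExchange [Fintype V] {G : SimpleGraph V} {M O : Finset (Sym2 V)}
    (hM : IsTwoMatching G M) (hO : IsTwoMatching G O) :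
    ∃ O', IsTwoMatching G O' ∧ O'.card = O.card ∧ NoExchange (Rel M) (Rel O') := by
  classical
  -- An exchange removes two edges outside `M` and adds two edges of `M`, so a maximiser of the
  -- overlap with `M` admits none.
  obtain ⟨O', hO', hmax⟩ := Finset.exists_max_image
    (Finset.univ.filter fun X : Finset (Sym2 V) => IsTwoMatching G X ∧ X.card = O.card)
    (fun X => (X ∩ M).card) ⟨O, by simp [hO]⟩
  simp only [Finset.mem_filter, Finset.mem_univ, true_and] at hO' hmax
  obtain ⟨hO', hc⟩ := hO'
  have ne : ∀ {a b}, Rel O' a b → a ≠ b := fun h e => hO'.twoRel.irrefl _ (e ▸ h)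
  have key : ∀ {w x y z s t : V}, Rel O' w x → Rel O' y z → Rel O' x s → Rel O' y t →
      ¬ Rel O' w y → ¬ Rel O' x z → Rel M w y → Rel M x z → ¬ Rel M w x → ¬ Rel M y z →
      w ≠ z → x ≠ y → (s = y ∧ t = x ∨ s = t ∧ s ≠ x ∧ s ≠ y) → False := by
    intro w x y z s t a1 a2 a3 a4 a5 a6 a7 a8 a9 a10 a11 a12 a13
    obtain ⟨h1, h2, h3⟩ := isTwoMatching_exchange hM hO' a1 a2 a3 a4 a5 a6 a7 a8 a9 a10 a11 a12 a13
    exact absurd (hmax _ ⟨h1, h2.trans hc⟩) (not_le.2 h3)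
  refine ⟨O', hO', hc, ?_, ?_⟩
  · intro w x y z a1 a2 a3 a4 a5 a6 a7 a8 a9
    refine key a1 a4 a3 a3.symm a7 a9 a6 a8 a2 a5 ?_ (ne a3) (.inl ⟨rfl, rfl⟩)
    rintro rfl
    exact a7 a4.symm
  · intro w x t y z a1 a2 a3 a4 a5 a6 a7 a8 a9 a10 a11
    refine key a1 a5 a3 a4.symm a8 a10 a7 a9 a2 a6 a11 ?_ (.inr ⟨rfl, (ne a3).symm, ne a4⟩)
    rintro rfl
    exact a8 a1

end Exchange

/-! ### Pairings of edges at nodes and the threads they form -/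

section Pairing

variable {V : Type*}

/-- At every node, `N` matches edges of `A` with edges of `B`, and all edges of one of the two
kinds are matched. -/
structure IsPairing (A B : V → V → Prop) (N : V → V → V → Prop) : Prop where
  left : ∀ {v a b}, N v a b → A v a
  right : ∀ {v a b}, N v a b → B v b
  compat : ∀ {v a b a' b'}, N v a b → N v a' b' → (a = a' ↔ b = b')
  maximal : ∀ v, (∀ a, A v a → ∃ b, N v a b) ∨ (∀ b, B v b → ∃ a, N v a b)

/-- Extend the prescribed pairs at each node to a maximal compatible set. If an edge of each kind
were left over at a node, these two could be paired. -/
theorem exists_isPairing [Finite V] {A B : V → V → Prop} {S : V → V → V → Prop}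
    (hA : ∀ {v a b}, S v a b → A v a) (hB : ∀ {v a b}, S v a b → B v b)
    (hS : ∀ {v a b a' b'}, S v a b → S v a' b' → (a = a' ↔ b = b')) :
    ∃ N, IsPairing A B N ∧ ∀ {v a b}, S v a b → N v a b := by
  have key : ∀ v, ∃ X : Set (V × V), {p : V × V | S v p.1 p.2} ⊆ X ∧
      Maximal (fun X : Set (V × V) => (∀ p ∈ X, A v p.1 ∧ B v p.2) ∧
        ∀ p ∈ X, ∀ q ∈ X, (p.1 = q.1 ↔ p.2 = q.2)) X := fun v =>
    Finite.exists_le_maximal ⟨fun p hp => ⟨hA hp, hB hp⟩, fun p hp q hq => hS hp hq⟩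
  choose X hX hmax using key
  refine ⟨fun v a b => (a, b) ∈ X v, ⟨fun h => ((hmax _).prop.1 _ h).1,
    fun h => ((hmax _).prop.1 _ h).2, fun h h' => (hmax _).prop.2 _ h _ h', fun v => ?_⟩,
    fun {v a b} h => hX v (by exact h)⟩
  by_contra! hcon
  obtain ⟨⟨a, ha, ha'⟩, b, hb, hb'⟩ := hcon
  have hins : insert (a, b) (X v) ⊆ X v := by
    refine (hmax v).le_of_ge ⟨?_, ?_⟩ (Set.subset_insert _ _)
    · rintro p (rfl | hp)
      exacts [⟨ha, hb⟩, (hmax v).prop.1 p hp]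
    · rintro ⟨p, p'⟩ (hp | hp) ⟨q, q'⟩ (hq | hq)
      · simp_all
      · simp only [Prod.mk.injEq] at hp
        obtain ⟨rfl, rfl⟩ := hp
        refine ⟨?_, ?_⟩
        · rintro rfl
          exact absurd hq (ha' _)
        · rintro rfl
          exact absurd hq (hb' _)
      · simp only [Prod.mk.injEq] at hq
        obtain ⟨rfl, rfl⟩ := hq
        refine ⟨?_, ?_⟩
        · rintro rfl
          exact absurd hp (ha' _)
        · rintro rfl
          exact absurd hp (hb' _)
      · exact (hmax v).prop.2 _ hp _ hq
  exact ha' b (hins (Set.mem_insert _ _))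

/-- The edges `yx` and `yz` are matched at `y`. -/
def Link (N : V → V → V → Prop) (y x z : V) : Prop := N y x z ∨ N y z x

theorem Link.symm {N : V → V → V → Prop} {y x z : V} (h : Link N y x z) : Link N y z x :=
  Or.symm h

/-- A set of edges that with an edge contains the edges matched with it. -/
def LinkClosed (N : V → V → V → Prop) (P : Finset (Sym2 V)) : Prop :=
  ∀ y x z, Link N y x z → s(y, x) ∈ P → s(y, z) ∈ P

/-- `Thread B N x y l`: following matched edges from an edge of `B` that is unmatched at one end
leads to the edge from `y` to `x`; the edges passed are `l`, the last one first. -/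
inductive Thread (B : V → V → Prop) (N : V → V → V → Prop) : V → V → List (Sym2 V) → Prop
  | start {x y} : B x y → (∀ z, ¬ Link N y x z) → Thread B N x y [s(x, y)]
  | cons {x y z l} : Thread B N y z l → Link N y x z → Thread B N x y (s(x, y) :: l)

variable {A B : V → V → Prop} {N : V → V → V → Prop}

theorem Thread.exists_cons {x y : V} {l} (h : Thread B N x y l) : ∃ l', l = s(x, y) :: l' := by
  cases h <;> exact ⟨_, rfl⟩

theorem Thread.mem {x y : V} {l} (h : Thread B N x y l) : s(x, y) ∈ l := by
  obtain ⟨l', rfl⟩ := h.exists_cons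
  simp

section

variable (hN : IsPairing A B N) (hAB : ∀ {x y}, A x y → ¬ B x y)
include hN hAB

theorem IsPairing.link_unique {y x z z' : V} (h : Link N y x z) (h' : Link N y x z') :
    z = z' := by
  rcases h with h | h <;> rcases h' with h' | h'
  · exact (hN.compat h h').1 rfl
  · exact absurd (hN.right h') (hAB (hN.left h))
  · exact absurd (hN.right h) (hAB (hN.left h'))
  · exact (hN.compat h h').2 rfl

theorem IsPairing.link_ne {y x z : V} (h : Link N y x z) : x ≠ z := by
  rintro rfl
  rcases h with h | h <;> exact hAB (hN.left h) (hN.right h)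

/-- A thread contains the partners of its edges at all ends but one: its first edge has no partner
at the starting end, and the latest edge need not have its partner in the list at the head `x`. -/
theorem Thread.closed {x y : V} {l} (h : Thread B N x y l) {p q r : V} (hpq : s(p, q) ∈ l)
    (hr : Link N q p r) : s(q, r) ∈ l ∨ (p = y ∧ q = x) := by
  induction h with
  | start hB hn =>
    simp only [List.mem_singleton, Sym2.eq_iff] at hpq
    rcases hpq with ⟨rfl, rfl⟩ | ⟨rfl, rfl⟩
    · exact absurd hr (hn _)
    · exact .inr ⟨rfl, rfl⟩
  | @cons x y z l ht hl ih =>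
    rcases List.mem_cons.1 hpq with hpq | hpq
    · rcases Sym2.eq_iff.1 hpq with ⟨rfl, rfl⟩ | ⟨rfl, rfl⟩
      · rw [← hN.link_unique hAB hl hr]
        exact .inl (List.mem_cons_of_mem _ ht.mem)
      · exact .inr ⟨rfl, rfl⟩
    · rcases ih hpq with h | ⟨rfl, rfl⟩
      · exact .inl (List.mem_cons_of_mem _ h)
      · rw [hN.link_unique hAB hr hl.symm, Sym2.eq_swap]
        exact .inl List.mem_cons_self

/-- The second claim, that the next edge is new, strengthens the induction. If the next edge were
already present, `Thread.closed` at its far end would already have put the latest edge into the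
earlier part of the thread. -/
theorem Thread.nodup_and (hA : ∀ x, ¬ A x x) (hB : ∀ x, ¬ B x x)
    {x y : V} {l} (h : Thread B N x y l) :
    l.Nodup ∧ ∀ r, Link N x y r → s(r, x) ∉ l := by
  have hne : ∀ {x y r}, Link N x y r → x ≠ y := by
    rintro x y r (h | h) rfl
    exacts [hA _ (hN.left h), hB _ (hN.right h)]
  have hself : ∀ {x y r}, Link N x y r → s(r, x) ≠ s(x, y) := by
    intro x y r h e
    rcases Sym2.eq_iff.1 e with ⟨rfl, rfl⟩ | ⟨rfl, -⟩
    exacts [hne h rfl, hN.link_ne hAB h rfl]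
  induction h with
  | start hB hn =>
    exact ⟨by simp, fun r hr => by simpa using hself hr⟩
  | @cons x y z l ht hl ih =>
    refine ⟨List.nodup_cons.2 ⟨ih.2 x hl.symm, ih.1⟩, fun r hr hmem => ?_⟩
    rcases List.mem_cons.1 hmem with h | h
    · exact hself hr h
    · rcases ht.closed hN hAB h hr.symm with h | ⟨-, rfl⟩
      · exact ih.2 x hl.symm h
      · exact hne hr rfl

end

theorem Thread.exists_walk {G : SimpleGraph V} (hG : ∀ {x y z}, Link N y x z → G.Adj x y)
    (hG' : ∀ {x y}, B x y → G.Adj x y) {x y : V} {l} (h : Thread B N x y l) :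
    ∃ (v : V) (w : G.Walk x v), w.edges = l := by
  induction h with
  | @start x y hB _ => exact ⟨y, .cons (hG' hB) .nil, by simp⟩
  | @cons x y z l ht hl ih =>
    obtain ⟨v, w, rfl⟩ := ih
    exact ⟨v, .cons (hG hl) w, by simp⟩

/-- A thread that never stopped would contain more distinct edges than the finite set `P`. -/
theorem Thread.exists_terminal (hN : IsPairing A B N) (hAB : ∀ {x y}, A x y → ¬ B x y)
    (hA : ∀ x, ¬ A x x) (hB : ∀ x, ¬ B x x)
    {P : Finset (Sym2 V)} (hP : LinkClosed N P) {x y : V} (h : B x y) (hxy : s(x, y) ∈ P)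
    (hn : ∀ z, ¬ Link N y x z) :
    ∃ x' y' l, Thread B N x' y' l ∧ (∀ r, ¬ Link N x' y' r) ∧ ∀ e ∈ l, e ∈ P := by
  have key : ∀ k, ∃ x' y' l, Thread B N x' y' l ∧ (∀ e ∈ l, e ∈ P) ∧
      ((∀ r, ¬ Link N x' y' r) ∨ k ≤ l.length) := by
    intro k
    induction k with
    | zero => exact ⟨x, y, _, .start h hn, by simpa using hxy, by simp⟩
    | succ k ih =>
      obtain ⟨x', y', l, ht, hl, h | hk⟩ := ih
      · exact ⟨x', y', l, ht, hl, .inl h⟩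
      · by_cases hr : ∀ r, ¬ Link N x' y' r
        · exact ⟨x', y', l, ht, hl, .inl hr⟩
        · push Not at hr
          obtain ⟨r, hr⟩ := hr
          refine ⟨r, x', _, .cons ht hr.symm, ?_, .inr (by simpa using hk)⟩
          have := hl _ ht.mem
          intro e he
          rcases List.mem_cons.1 he with rfl | he
          · rw [Sym2.eq_swap]
            exact hP _ _ _ hr this
          · exact hl _ he
  classical
  obtain ⟨x', y', l, ht, hl, h⟩ := key (P.card + 1)
  refine ⟨x', y', l, ht, h.resolve_right fun hlen => ?_, hl⟩
  have h1 := (ht.nodup_and hN hAB hA hB).1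
  have h2 : l.toFinset ⊆ P := fun e he => hl e (by simpa using he)
  have h3 := Finset.card_le_card h2
  rw [List.toFinset_card_of_nodup h1] at h3
  omega

end Pairing

/-! ### Comparing cardinalities through degrees -/

section Degree

variable {V : Type*} [DecidableEq V]

theorem card_incident_le {v : V} {E F : Finset (Sym2 V)} (R : V → V → Prop)
    (hR : ∀ b, s(v, b) ∈ E → ∃ a, s(v, a) ∈ F ∧ R b a)
    (hinj : ∀ {b b' a}, R b a → R b' a → b = b') :
    (E.filter (v ∈ ·)).card ≤ (F.filter (v ∈ ·)).card := by
  refine Finset.card_le_card_of_forall_subsingleton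
    (fun e f => ∃ b a, e = s(v, b) ∧ f = s(v, a) ∧ R b a) ?_ ?_
  · intro e he
    obtain ⟨he, b, rfl⟩ := Finset.mem_filter.1 he
    obtain ⟨a, ha, hba⟩ := hR b he
    exact ⟨s(v, a), by simp [ha], b, a, rfl, rfl, hba⟩
  · rintro f - e ⟨-, b, a, rfl, rfl, hba⟩ e' ⟨-, b', a', rfl, h, hba'⟩
    obtain rfl : a = a' := by
      rcases Sym2.eq_iff.1 h with ⟨-, h⟩ | ⟨h₁, h₂⟩
      exacts [h, h₂.trans h₁]
    rw [hinj hba hba']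

theorem sum_card_incident [Fintype V] {F : Finset (Sym2 V)} (hF : ∀ v, s(v, v) ∉ F) :
    ∑ v, (F.filter (v ∈ ·)).card = 2 * F.card := by
  have := Finset.sum_card_bipartiteAbove_eq_sum_card_bipartiteBelow (s := Finset.univ) (t := F)
    (fun (v : V) e => v ∈ e)
  simp only [Finset.bipartiteAbove, Finset.bipartiteBelow] at this
  rw [this, Finset.sum_const_nat (m := 2), mul_comm]
  intro e he
  induction e with | _ x y
  have hxy : x ≠ y := by rintro rfl; exact hF _ he
  rw [← Finset.card_pair hxy]
  congr 1
  ext v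
  simp

theorem card_le_card_of_incident [Fintype V] {E F : Finset (Sym2 V)} (hE : ∀ v, s(v, v) ∉ E)
    (hF : ∀ v, s(v, v) ∉ F) (h : ∀ v, (E.filter (v ∈ ·)).card ≤ (F.filter (v ∈ ·)).card) :
    E.card ≤ F.card := by
  have := Finset.sum_le_sum fun v (_ : v ∈ Finset.univ) => h v
  rw [sum_card_incident hE, sum_card_incident hF] at this
  omega

theorem IsTwoMatching.card_le [Fintype V] {G : SimpleGraph V} {M : Finset (Sym2 V)}
    (h : IsTwoMatching G M) : M.card ≤ Fintype.card V := by
  have h1 := sum_card_incident (F := M) fun v => h.twoRel.irrefl v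
  have h2 := Finset.sum_le_sum fun v (_ : v ∈ Finset.univ) => h.2.1 v
  simp only [Finset.sum_const, Finset.card_univ, smul_eq_mul] at h2
  have h3 : ∑ v, (M.filter (v ∈ ·)).card = ∑ v, (M.filter (fun e => v ∈ e)).card := rfl
  omega

end Degree

/-! ### Flipping closed sets and finding a short augmenting trail -/

section Augment

theorem LinkClosed.mem_iff {V : Type*} {N : V → V → V → Prop} {P : Finset (Sym2 V)}
    (hP : LinkClosed N P) {v a b : V} (h : N v a b) : Rel P v a ↔ Rel P v b :=
  ⟨hP _ _ _ (.inl h), hP _ _ _ (.inr h)⟩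

variable {V : Type*} [DecidableEq V]

theorem rel_sdiff {M O : Finset (Sym2 V)} {x y : V} :
    Rel (M \ O) x y ↔ Rel M x y ∧ ¬ Rel O x y := Finset.mem_sdiff

theorem rel_symmDiff {M P : Finset (Sym2 V)} {x y : V} :
    Rel (M ∆ P) x y ↔ (Rel M x y ∧ ¬ Rel P x y) ∨ (Rel P x y ∧ ¬ Rel M x y) :=
  Finset.mem_symmDiff

variable {G : SimpleGraph V} {M O : Finset (Sym2 V)} {N : V → V → V → Prop}

/-- Flipping a set of edges closed under a pairing that hits all triangles preserves triangle-free
2-matchings. -/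
theorem isTwoMatching_symmDiff (hM : IsTwoMatching G M) (hO : IsTwoMatching G O)
    (hN : IsPairing (Rel (M \ O)) (Rel (O \ M)) N)
    (hhit : ∀ {v a b}, Corner (Rel M) (Rel O) v a b → N v a b ∨
      (Rel M a b ∧ ¬ Rel O a b ∧ N b a v) ∨ (Rel O a b ∧ ¬ Rel M a b ∧ N a v b))
    {P : Finset (Sym2 V)} (hP : LinkClosed N P) (hPO : ∀ e ∈ P, e ∈ M ∆ O) :
    IsTwoMatching G (M ∆ P) := by
  have hMO : ∀ {x y}, Rel P x y → ¬ Rel M x y → Rel O x y := by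
    intro x y h h'
    rcases Finset.mem_symmDiff.1 (hPO _ h) with h1 | h1
    exacts [absurd h1.1 h', h1.1]
  have hMO' : ∀ {x y}, Rel P x y → Rel M x y → ¬ Rel O x y := by
    intro x y h h'
    rcases Finset.mem_symmDiff.1 (hPO _ h) with h1 | h1
    exacts [h1.2, absurd h' h1.2]
  refine ⟨fun e he => ?_, fun v => ?_, ?_⟩
  · rcases Finset.mem_symmDiff.1 he with h | h
    · exact hM.1 _ h.1
    · rcases Finset.mem_symmDiff.1 (hPO _ h.1) with h1 | h1
      exacts [absurd h1.1 h.2, hO.1 _ h1.1]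
  · rcases hN.maximal v with h | h
    -- All edges of `M \ O` at `v` are paired here. Edges of `O` are charged to themselves and a
    -- kept edge of `M \ O` to its partner, which is not flipped in and so is still free.
    · refine (card_incident_le (F := O) (fun b a => (Rel O v b ∧ Rel (M ∆ P) v b ∧ a = b) ∨
        (Rel (M \ O) v b ∧ ¬ Rel P v b ∧ N v b a)) ?_ ?_).trans (hO.2.1 v)
      · intro b hb
        by_cases hbO : Rel O v b
        · exact ⟨b, hbO, .inl ⟨hbO, hb, rfl⟩⟩
        · rcases rel_symmDiff.1 hb with hb | hb
          · obtain ⟨a, ha⟩ := h b (rel_sdiff.2 ⟨hb.1, hbO⟩)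
            exact ⟨a, (rel_sdiff.1 (hN.right ha)).1, .inr ⟨rel_sdiff.2 ⟨hb.1, hbO⟩, hb.2, ha⟩⟩
          · exact absurd (hMO hb.1 hb.2) hbO
      · have aux : ∀ {b b' : V}, Rel (M ∆ P) v b → ¬ Rel P v b' → N v b' b → False := by
          intro b b' hb hb' hn
          rcases rel_symmDiff.1 hb with hb | hb
          · exact (rel_sdiff.1 (hN.right hn)).2 hb.1
          · exact hb' ((hP.mem_iff hn).2 hb.1)
        rintro b b' a (⟨-, hb, rfl⟩ | ⟨-, hb, hn⟩) (⟨-, hb', rfl⟩ | ⟨-, hb', hn'⟩)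
        · rfl
        · exact (aux hb hb' hn').elim
        · exact (aux hb' hb hn).elim
        · exact (hN.compat hn hn').2 rfl
    -- All edges of `O \ M` at `v` are paired here. An edge flipped in is charged to its partner,
    -- which is flipped out.
    · refine (card_incident_le (F := M) (fun b a => (¬ Rel P v b ∧ a = b) ∨
        (Rel P v b ∧ N v a b)) ?_ ?_).trans (hM.2.1 v)
      · intro b hb
        rcases rel_symmDiff.1 hb with hb | hb
        · exact ⟨b, hb.1, .inl ⟨hb.2, rfl⟩⟩
        · obtain ⟨a, ha⟩ := h b (rel_sdiff.2 ⟨hMO hb.1 hb.2, hb.2⟩)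
          exact ⟨a, (rel_sdiff.1 (hN.left ha)).1, .inr ⟨hb.1, ha⟩⟩
      · rintro b b' a (⟨hb, rfl⟩ | ⟨hb, hn⟩) (⟨hb', rfl⟩ | ⟨hb', hn'⟩)
        · rfl
        · exact absurd ((hP.mem_iff hn').2 hb') hb
        · exact absurd ((hP.mem_iff hn).2 hb) hb'
        · exact (hN.compat hn hn').1 rfl
  -- A triangle after the flip has an edge outside `O` and an edge outside `M`. They differ, so they
  -- meet in a node `v` and form a corner; whichever corner of the triangle is paired, closedness of
  -- `P` gives a contradiction.
  · have key : ∀ {v a b}, Rel (M ∆ P) v a → Rel (M ∆ P) v b → Rel (M ∆ P) a b →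
        ¬ Rel O v a → ¬ Rel M v b → False := by
      intro v a b va vb ab hva hvb
      have va' : Rel M v a ∧ ¬ Rel P v a := by
        rcases rel_symmDiff.1 va with h | h
        exacts [h, absurd (hMO h.1 h.2) hva]
      have vb' : Rel P v b ∧ ¬ Rel M v b := by
        rcases rel_symmDiff.1 vb with h | h
        exacts [absurd h.1 hvb, h]
      rw [rel_symmDiff] at ab
      have hc : Corner (Rel M) (Rel O) v a b :=
        ⟨va'.1, hva, hMO vb'.1 hvb, hvb, ab.imp (·.1) fun h => hMO h.1 h.2⟩
      rcases hhit hc with h | ⟨h1, h2, h⟩ | ⟨h1, h2, h⟩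
      · exact va'.2 ((hP.mem_iff h).2 vb'.1)
      · rcases ab with h' | h'
        · exact h'.2 ((hP.mem_iff h).2 vb'.1.symm).symm
        · exact h'.2 h1
      · rcases ab with h' | h'
        · exact h2 h'.1
        · exact va'.2 ((hP.mem_iff h).2 h'.1).symm
    intro s hs
    obtain ⟨x, y, z, hxy, hxz, hyz, -⟩ := SimpleGraph.is3Clique_iff.1 hs
    simp only [SimpleGraph.fromEdgeSet_adj, Finset.mem_coe] at hxy hxz hyz
    have xy : Rel (M ∆ P) x y := hxy.1
    have xz : Rel (M ∆ P) x z := hxz.1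
    have yz : Rel (M ∆ P) y z := hyz.1
    have cover : ∀ {x y}, Rel (M ∆ P) x y → Rel M x y ∨ Rel O x y := fun h =>
      (rel_symmDiff.1 h).imp (·.1) fun h => hMO h.1 h.2
    have h1 : ¬ Rel M x y ∨ ¬ Rel M x z ∨ ¬ Rel M y z := by
      by_contra! h
      exact hM.twoRel.tri h.1 h.2.2 h.2.1
    have h2 : ¬ Rel O x y ∨ ¬ Rel O x z ∨ ¬ Rel O y z := by
      by_contra! h
      exact hO.twoRel.tri h.1 h.2.2 h.2.1
    have symm : ∀ {X : Finset (Sym2 V)} {x y : V}, ¬ Rel X x y → ¬ Rel X y x := fun h h' =>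
      h h'.symm
    rcases h1 with h1 | h1 | h1 <;> rcases h2 with h2 | h2 | h2
    · exact (cover xy).elim h1 h2
    · exact key xz xy yz.symm h2 h1
    · exact key yz xy.symm xz.symm h2 (symm h1)
    · exact key xy xz yz h2 h1
    · exact (cover xz).elim h1 h2
    · exact key yz.symm xz.symm xy.symm (symm h2) (symm h1)
    · exact key xy.symm yz xz (symm h2) h1
    · exact key xz.symm yz.symm xy (symm h2) (symm h1)
    · exact (cover yz).elim h1 h2

theorem Thread.isChain (hN : IsPairing (Rel (M \ O)) (Rel (O \ M)) N) {x y : V} {l}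
    (h : Thread (Rel (O \ M)) N x y l) :
    l.IsChain (fun e f => (e ∈ M ∧ f ∉ M) ∨ (e ∉ M ∧ f ∈ M)) := by
  induction h with
  | start => simp
  | @cons x y z l ht hl ih =>
    obtain ⟨l', rfl⟩ := ht.exists_cons
    refine List.isChain_cons_cons.2 ⟨?_, ih⟩
    rw [Sym2.eq_swap]
    rcases hl with h | h
    · exact .inl ⟨(rel_sdiff.1 (hN.left h)).1, (rel_sdiff.1 (hN.right h)).2⟩
    · exact .inr ⟨(rel_sdiff.1 (hN.right h)).2, (rel_sdiff.1 (hN.left h)).1⟩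

/-- The thread alternates and starts outside `M`, so its surplus is determined by its latest edge.
-/
theorem Thread.countP (hN : IsPairing (Rel (M \ O)) (Rel (O \ M)) N) {x y : V} {l}
    (h : Thread (Rel (O \ M)) N x y l) :
    (Rel M x y → l.countP (· ∉ M) = l.countP (· ∈ M)) ∧
    (¬ Rel M x y → l.countP (· ∉ M) = l.countP (· ∈ M) + 1) := by
  induction h with
  | @start x y hB _ =>
    have hB : s(x, y) ∉ M := (rel_sdiff.1 hB).2
    simp [Rel, hB]
  | @cons x y z l ht hl ih =>
    rw [rel_comm]
    simp only [Rel, List.countP_cons] at ih ⊢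
    rw [Sym2.eq_swap (a := x)]
    rcases hl with h | h
    · have h1 : s(y, x) ∈ M := (rel_sdiff.1 (hN.left h)).1
      have h2 : s(y, z) ∉ M := (rel_sdiff.1 (hN.right h)).2
      simpa [h1] using ih.2 h2
    · have h1 : s(y, z) ∈ M := (rel_sdiff.1 (hN.left h)).1
      have h2 : s(y, x) ∉ M := (rel_sdiff.1 (hN.right h)).2
      simpa [h2] using ih.1 h1

theorem card_toFinset_filter {α : Type*} [DecidableEq α] {l : List α} (h : l.Nodup) (p : α → Prop)
    [DecidablePred p] : (l.toFinset.filter p).card = l.countP p := by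
  rw [List.countP_eq_length_filter, ← List.toFinset_card_of_nodup (h.filter _)]
  congr 1
  ext
  simp

theorem card_symmDiff_add (M P : Finset (Sym2 V)) :
    (M ∆ P).card + (P.filter (· ∈ M)).card = M.card + (P.filter (· ∉ M)).card := by
  have h1 : (M ∆ P).card = (M \ P).card + (P \ M).card :=
    Finset.card_union_of_disjoint (by
      rw [Finset.disjoint_left]
      intro e he he'
      exact (Finset.mem_sdiff.1 he).2 (Finset.mem_sdiff.1 he').1)
  have h2 : P.filter (· ∈ M) = M ∩ P := by ext; simp [and_comm]
  have h3 : P.filter (· ∉ M) = P \ M := by ext; simp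
  have h4 := Finset.card_sdiff_add_card_inter M P
  rw [h1, h2, h3]
  omega

variable [Fintype V]

/-- Without a short augmenting trail, each unit of surplus of `O` over `M` uses `K + 1` edges of `O
\ M` of its own. -/
theorem exists_augmentingTrail (hM : IsTwoMatching G M) (hO : IsTwoMatching G O)
    (hx : NoExchange (Rel M) (Rel O)) {K : ℕ} (hK : O.card < (K + 1) * (O.card - M.card)) :
    ∃ (u v : V) (w : G.Walk u v), IsAugmentingTrail G M w ∧ w.length + 1 ≤ 2 * K := by
  obtain ⟨f, hf⟩ : ∃ f : V → ℕ, f.Injective :=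
    ⟨fun v => Fintype.equivFin V v, fun a b h => by simpa [Fin.val_inj] using h⟩
  obtain ⟨N, hN, hS⟩ := exists_isPairing (A := Rel (M \ O)) (B := Rel (O \ M))
    (S := Selected f (Rel M) (Rel O)) (fun h => rel_sdiff.2 ⟨h.1.1, h.1.2.1⟩)
    (fun h => rel_sdiff.2 ⟨h.1.2.2.1, h.1.2.2.2.1⟩)
    (fun h h' => h.compat hf hM.twoRel hO.twoRel hx h')
  have hhit : ∀ {v a b}, Corner (Rel M) (Rel O) v a b → N v a b ∨
      (Rel M a b ∧ ¬ Rel O a b ∧ N b a v) ∨ (Rel O a b ∧ ¬ Rel M a b ∧ N a v b) := by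
    intro v a b h
    rcases h.selected_or hf hM.twoRel hO.twoRel with h | ⟨h1, h2, h⟩ | ⟨h1, h2, h⟩
    exacts [.inl (hS h), .inr (.inl ⟨h1, h2, hS h⟩), .inr (.inr ⟨h1, h2, hS h⟩)]
  have hAB : ∀ {x y}, Rel (M \ O) x y → ¬ Rel (O \ M) x y := fun h h' =>
    (rel_sdiff.1 h).2 (rel_sdiff.1 h').1
  have hA : ∀ x, ¬ Rel (M \ O) x x := fun x h => hM.twoRel.irrefl x (rel_sdiff.1 h).1
  have hB : ∀ x, ¬ Rel (O \ M) x x := fun x h => hO.twoRel.irrefl x (rel_sdiff.1 h).1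
  by_contra! hno
  -- Threads are removed from a closed set one at a time. The subtraction is truncated, so closed
  -- sets without surplus, such as alternating cycles, need no further decomposition.
  have key : ∀ n, ∀ P : Finset (Sym2 V), P.card = n → LinkClosed N P → (∀ e ∈ P, e ∈ M ∆ O) →
      (K + 1) * ((P.filter (· ∉ M)).card - (P.filter (· ∈ M)).card) ≤
        (P.filter (· ∉ M)).card := by
    intro n
    induction n using Nat.strong_induction_on with | _ n ih
    intro P hn hP hPO
    rcases Nat.lt_or_ge (P.filter (· ∈ M)).card (P.filter (· ∉ M)).card with hlt | hge
    swap
    · simp [Nat.sub_eq_zero_of_le hge]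
    have hPirr : ∀ v, s(v, v) ∉ P := by
      intro v h
      rcases Finset.mem_symmDiff.1 (hPO _ h) with h | h
      exacts [hM.twoRel.irrefl v h.1, hO.twoRel.irrefl v h.1]
    -- If every edge of `P` outside `M` were paired at both ends, then at each node `P` would have
    -- at least as many edges of `M` as others, contradicting the surplus.
    have hstart : ∃ x y, Rel (O \ M) x y ∧ s(x, y) ∈ P ∧ ∀ z, ¬ Link N y x z := by
      by_contra! hcon
      refine absurd (card_le_card_of_incident (E := P.filter (· ∉ M)) (F := P.filter (· ∈ M))
        (fun v h => hPirr v (Finset.mem_filter.1 h).1)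
        (fun v h => hPirr v (Finset.mem_filter.1 h).1) fun v => ?_) (not_le.2 hlt)
      refine card_incident_le (fun b a => N v a b) (fun b hb => ?_)
        fun h h' => (hN.compat h h').1 rfl
      obtain ⟨hb, hb'⟩ := Finset.mem_filter.1 hb
      have hbO : Rel (O \ M) b v := by
        rcases Finset.mem_symmDiff.1 (hPO _ hb) with h | h
        exacts [absurd h.1 hb', Rel.symm (rel_sdiff.2 h)]
      obtain ⟨z, hz⟩ := hcon b v hbO (by rwa [Sym2.eq_swap])
      rcases hz with hz | hz
      · exact absurd hbO (fun h => hAB (hN.left hz) h.symm)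
      · exact ⟨z, Finset.mem_filter.2 ⟨(hP.mem_iff hz).2 hb, (rel_sdiff.1 (hN.left hz)).1⟩, hz⟩
    obtain ⟨x₀, y₀, hB₀, hP₀, hn₀⟩ := hstart
    obtain ⟨x, y, l, ht, hterm, hlP⟩ :=
      Thread.exists_terminal hN hAB hA hB hP hB₀ hP₀ hn₀
    have hnd := (ht.nodup_and hN hAB hA hB).1
    have hlc : LinkClosed N l.toFinset := by
      intro q p r hr hpq
      rw [List.mem_toFinset] at hpq ⊢
      rcases ht.closed hN hAB (by rwa [Sym2.eq_swap] at hpq) hr with h | ⟨rfl, rfl⟩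
      exacts [h, absurd hr (hterm _)]
    have hsub : l.toFinset ⊆ P := fun e he => hlP e (List.mem_toFinset.1 he)
    have hc1 := card_toFinset_filter hnd (· ∈ M)
    have hc2 := card_toFinset_filter hnd (· ∉ M)
    have hcount := ht.countP hN
    have hf1 : ((P \ l.toFinset).filter (· ∈ M)).card + (l.toFinset.filter (· ∈ M)).card =
        (P.filter (· ∈ M)).card := by
      rw [← Finset.card_sdiff_add_card_eq_card (Finset.filter_subset_filter (· ∈ M) hsub)]
      congr 2
      ext
      simp only [Finset.mem_filter, Finset.mem_sdiff]
      tauto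
    have hf2 : ((P \ l.toFinset).filter (· ∉ M)).card + (l.toFinset.filter (· ∉ M)).card =
        (P.filter (· ∉ M)).card := by
      rw [← Finset.card_sdiff_add_card_eq_card (Finset.filter_subset_filter (· ∉ M) hsub)]
      congr 2
      ext
      simp only [Finset.mem_filter, Finset.mem_sdiff]
      tauto
    have hrec := ih (P \ l.toFinset).card (by
      rw [← hn]
      refine Finset.card_lt_card (Finset.ssubset_iff_of_subset Finset.sdiff_subset |>.2 ?_)
      exact ⟨_, hlP _ ht.mem, by simp [ht.mem]⟩) (P \ l.toFinset) rfl (by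
        intro q p r hr hpq
        rw [Finset.mem_sdiff] at hpq ⊢
        exact ⟨hP _ _ _ hr hpq.1, fun h => hpq.2 (hlc _ _ _ hr.symm h)⟩)
        (fun e he => hPO e (Finset.mem_sdiff.1 he).1)
    by_cases hxy : Rel M x y
    · have := hcount.1 hxy
      have e : (P.filter (· ∉ M)).card - (P.filter (· ∈ M)).card =
        ((P \ l.toFinset).filter (· ∉ M)).card - ((P \ l.toFinset).filter (· ∈ M)).card := by omega
      rw [e]
      omega
    · have hc := hcount.2 hxy
      obtain ⟨v, w, hw⟩ := ht.exists_walk (G := G)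
        (fun {y x z} h => by
          rcases h with h | h
          · exact (hM.1 _ (rel_sdiff.1 (hN.left h)).1 : G.Adj _ _).symm
          · exact (hO.1 _ (rel_sdiff.1 (hN.right h)).1 : G.Adj _ _).symm)
        (fun h => hO.1 _ (rel_sdiff.1 h).1)
      have haug : IsAugmentingTrail G M w := by
        refine ⟨⟨by rwa [hw]⟩, by rw [hw]; exact ht.isChain hN, ?_, ?_⟩
        · rw [hw]
          exact isTwoMatching_symmDiff hM hO hN hhit hlc fun e he => hPO e (hsub he)
        · have := card_symmDiff_add M l.toFinset
          rw [hw]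
          omega
      -- This trail has one more edge outside `M` than inside. Its length is therefore odd and at
      -- least `2K + 1`, so at least `K + 1` of its edges lie outside `M`.
      have hlen := hno _ _ w haug
      rw [← SimpleGraph.Walk.length_edges, hw,
        List.length_eq_countP_add_countP (p := (decide <| · ∈ M))] at hlen
      have e1 : l.countP (fun a => decide ¬ (decide (a ∈ M) = true)) = l.countP (· ∉ M) := by
        congr 1
        ext a
        simp
      rw [e1] at hlen
      have e2 : (P.filter (· ∉ M)).card - (P.filter (· ∈ M)).card =
        ((P \ l.toFinset).filter (· ∉ M)).card - ((P \ l.toFinset).filter (· ∈ M)).card + 1 := by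
        omega
      rw [e2, mul_add, mul_one]
      omega
  have hfin := key _ (M ∆ O) rfl (by
    intro y x z h _
    refine Finset.mem_symmDiff.2 ?_
    rcases h with h | h
    · exact .inr (Finset.mem_sdiff.1 (hN.right h))
    · exact .inl (Finset.mem_sdiff.1 (hN.left h))) (fun e he => he)
  have e1 : (M ∆ O).filter (· ∉ M) = O \ M := by
    ext e
    simp only [Finset.mem_filter, Finset.mem_symmDiff, Finset.mem_sdiff]
    tauto
  have e2 : (M ∆ O).filter (· ∈ M) = M \ O := by
    ext e
    simp only [Finset.mem_filter, Finset.mem_symmDiff, Finset.mem_sdiff]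
    tauto
  rw [e1, e2] at hfin
  have h1 := Finset.card_sdiff_add_card_inter M O
  have h2 := Finset.card_sdiff_add_card_inter O M
  rw [Finset.inter_comm] at h2
  have e3 : (O \ M).card - (M \ O).card = O.card - M.card := by omega
  rw [e3] at hfin
  omega

end Augment

/-! ### Flip bound and approximation ratio -/

section LocalSearch

variable {V : Type*} [DecidableEq V] {G : SimpleGraph V}

theorem isTwoMatching_empty : IsTwoMatching G ∅ := by
  refine isTwoMatching_iff.2 ⟨by simp, ?_, ?_, ?_, ?_⟩ <;> simp [Rel]

theorem Flip.isTwoMatching {L : ℝ} {M M' : Finset (Sym2 V)} (h : Flip G L M M') :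
    IsTwoMatching G M' ∧ M'.card = M.card + 1 := by
  obtain ⟨u, v, w, hw, -, rfl⟩ := h
  exact hw.2.2

theorem Run.isTwoMatching {L : ℝ} {k : ℕ} {M : Finset (Sym2 V)} (h : Run G L k M) :
    IsTwoMatching G M ∧ M.card = k := by
  induction h with
  | start => exact ⟨isTwoMatching_empty, rfl⟩
  | flip _ hf ih => exact ⟨hf.isTwoMatching.1, by rw [hf.isTwoMatching.2, ih.2]⟩

variable [Fintype V]

theorem Run.le_card {L : ℝ} {k : ℕ} {M : Finset (Sym2 V)} (h : Run G L k M) :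
    k ≤ Fintype.card V := h.isTwoMatching.2 ▸ h.isTwoMatching.1.card_le

theorem IsLocalSearchResult.le_card {ε : ℝ} (hε : 0 < ε) {M O : Finset (Sym2 V)}
    (h : IsLocalSearchResult G (2 / ε) M) (hO : IsTwoMatching G O) :
    (1 - ε) * (O.card : ℝ) ≤ M.card := by
  obtain ⟨⟨k, hk⟩, hterm⟩ := h
  by_contra! hlt
  obtain ⟨O', hO', hc, hx⟩ := exists_noExchange hk.isTwoMatching.1 hO
  rw [← hc] at hlt
  have hεO : 0 ≤ ε * (O'.card : ℝ) := by positivity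
  have hle : M.card ≤ O'.card := by
    have : (M.card : ℝ) ≤ O'.card := by linarith
    exact_mod_cast this
  -- With `K = ⌊1/ε⌋`, the bound `1/ε < K + 1` gives the counting hypothesis and `2K ≤ 2/ε` makes
  -- the trail found short enough.
  have hK := Nat.lt_floor_add_one (1 / ε)
  have hK' := Nat.floor_le (show 0 ≤ 1 / ε by positivity)
  have hlt' : O'.card < (⌊1 / ε⌋₊ + 1) * (O'.card - M.card) := by
    have : (O'.card : ℝ) < (⌊1 / ε⌋₊ + 1) * ((O'.card : ℝ) - M.card) := by
      have h1 : ε * O'.card < (O'.card : ℝ) - M.card := by linarith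
      calc (O'.card : ℝ) = 1 / ε * (ε * O'.card) := by field_simp
        _ < 1 / ε * ((O'.card : ℝ) - M.card) := by gcongr
        _ ≤ _ := by gcongr; linarith
    exact_mod_cast this
  obtain ⟨u, v, w, hw, hlen⟩ := exists_augmentingTrail hk.isTwoMatching.1 hO' hx hlt'
  refine hterm _ ⟨u, v, w, hw, ?_, rfl⟩
  have : (w.length : ℝ) + 1 ≤ 2 * ⌊1 / ε⌋₊ := by exact_mod_cast hlen
  rw [div_eq_mul_one_div]
  linarith

end LocalSearch

/-! ### Total correctness with time bounds for the machine -/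

section Machine

/-- The registers that a program may write. -/
def Program.regs : Program → List ℕ
  | .skip => []
  | .const r _ => [r]
  | .copy r _ => [r]
  | .add r _ _ => [r]
  | .sub r _ _ => [r]
  | .load r _ _ => [r]
  | .store _ _ _ => []
  | .seq P Q => P.regs ++ Q.regs
  | .ifLt _ _ P Q => P.regs ++ Q.regs
  | .whileLt _ _ P => P.regs

/-- The arrays that a program may write. -/
def Program.arrs : Program → List ℕ
  | .store k _ _ => [k]
  | .seq P Q => P.arrs ++ Q.arrs
  | .ifLt _ _ P Q => P.arrs ++ Q.arrs
  | .whileLt _ _ P => P.arrs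
  | _ => []

/-- The effect of a program without loops. -/
def Program.eval : Program → State → State
  | .skip, s => s
  | .const r c, s => s.setReg r c
  | .copy r a, s => s.setReg r (s.reg a)
  | .add r a b, s => s.setReg r (s.reg a + s.reg b)
  | .sub r a b, s => s.setReg r (s.reg a - s.reg b)
  | .load r k a, s => s.setReg r (s.arr k (s.reg a))
  | .store k a b, s => s.setArr k (s.reg a) (s.reg b)
  | .seq P Q, s => Q.eval (P.eval s)
  | .ifLt a b P Q, s => if s.reg a < s.reg b then P.eval s else Q.eval s
  | .whileLt _ _ _, s => s

/-- A program without loops. -/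
def Program.isFlat : Program → Bool
  | .seq P Q => P.isFlat && Q.isFlat
  | .ifLt _ _ P Q => P.isFlat && Q.isFlat
  | .whileLt _ _ _ => false
  | _ => true

/-- A bound on the number of steps of a program without loops. -/
def Program.cost : Program → ℕ
  | .seq P Q => P.cost + Q.cost
  | .ifLt _ _ P Q => P.cost + Q.cost + 1
  | _ => 1

theorem State.setReg_reg (s : State) (r x k : ℕ) :
    (s.setReg r x).reg k = if k = r then x else s.reg k := by
  simp [State.setReg, Function.update_apply]

theorem State.setReg_arr (s : State) (r x : ℕ) : (s.setReg r x).arr = s.arr := rfl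

theorem State.setArr_reg (s : State) (k i x : ℕ) : (s.setArr k i x).reg = s.reg := rfl

theorem State.setArr_arr (s : State) (k i x k' : ℕ) :
    (s.setArr k i x).arr k' = if k' = k then Function.update (s.arr k) i x else s.arr k' := by
  simp only [State.setArr, Function.update_apply]

/-- The states agree outside the given registers and arrays. -/
def Agree (rs as : List ℕ) (s s' : State) : Prop :=
  (∀ r, r ∉ rs → s'.reg r = s.reg r) ∧ (∀ k, k ∉ as → s'.arr k = s.arr k)

theorem Agree.trans {rs as : List ℕ} {s s' s'' : State} (h : Agree rs as s s')
    (h' : Agree rs as s' s'') : Agree rs as s s'' :=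
  ⟨fun r hr => (h'.1 r hr).trans (h.1 r hr), fun k hk => (h'.2 k hk).trans (h.2 k hk)⟩

theorem Agree.mono {rs as rs' as' : List ℕ} {s s' : State} (h : Agree rs as s s')
    (hr : ∀ r ∈ rs, r ∈ rs') (ha : ∀ k ∈ as, k ∈ as') : Agree rs' as' s s' :=
  ⟨fun r h' => h.1 r fun h'' => h' (hr r h''), fun k h' => h.2 k fun h'' => h' (ha k h'')⟩

theorem agree_setReg {rs as : List ℕ} {s : State} {r x : ℕ} (hr : r ∈ rs) :
    Agree rs as s (s.setReg r x) := by
  refine ⟨fun k hk => ?_, fun k _ => rfl⟩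
  rw [State.setReg_reg, if_neg]
  rintro rfl
  exact hk hr

theorem Exec.agree {P : Program} {s s' : State} {t : ℕ} (h : Exec P s s' t) :
    Agree P.regs P.arrs s s' := by
  induction h with
  | skip => exact ⟨fun _ _ => rfl, fun _ _ => rfl⟩
  | store k a b s =>
    refine ⟨fun _ _ => rfl, fun j hj => ?_⟩
    rw [State.setArr_arr, if_neg (by simpa [Program.arrs] using hj)]
  | seq _ _ ih₁ ih₂ =>
    exact (ih₁.mono (by simp +contextual [Program.regs]) (by simp +contextual [Program.arrs])).trans
      (ih₂.mono (by simp +contextual [Program.regs]) (by simp +contextual [Program.arrs]))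
  | ifTrue _ _ ih =>
    exact ih.mono (by simp +contextual [Program.regs]) (by simp +contextual [Program.arrs])
  | ifFalse _ _ ih =>
    exact ih.mono (by simp +contextual [Program.regs]) (by simp +contextual [Program.arrs])
  | whileTrue _ _ _ ih₁ ih₂ => exact Agree.trans ih₁ ih₂
  | whileFalse => exact ⟨fun _ _ => rfl, fun _ _ => rfl⟩
  | _ => exact agree_setReg (by simp [Program.regs])

/-- Started in `s`, the program halts after at most `T` steps in a state that satisfies `Q`. -/
def Ends (P : Program) (s : State) (T : ℕ) (Q : State → Prop) : Prop :=
  ∃ s' t, Exec P s s' t ∧ t ≤ T ∧ Q s'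

variable {P P' : Program} {s : State} {T T' : ℕ} {Q Q' : State → Prop}

theorem Ends.mono (h : Ends P s T Q) (hT : T ≤ T') (hQ : ∀ s', Agree P.regs P.arrs s s' →
    Q s' → Q' s') : Ends P s T' Q' := by
  obtain ⟨s', t, he, ht, hq⟩ := h
  exact ⟨s', t, he, ht.trans hT, hQ s' he.agree hq⟩

theorem Ends.seq (h : Ends P s T fun s' => Agree P.regs P.arrs s s' → Ends P' s' T' Q) :
    Ends (.seq P P') s (T + T') Q := by
  obtain ⟨s₁, t₁, he₁, ht₁, h⟩ := h
  obtain ⟨s₂, t₂, he₂, ht₂, h⟩ := h he₁.agree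
  exact ⟨s₂, _, .seq he₁ he₂, by omega, h⟩

theorem ends_ifLt {a b : ℕ} (h : s.reg a < s.reg b → Ends P s T Q)
    (h' : ¬ s.reg a < s.reg b → Ends P' s T Q) : Ends (.ifLt a b P P') s (T + 1) Q := by
  by_cases hlt : s.reg a < s.reg b
  · obtain ⟨s', t, he, ht, hq⟩ := h hlt
    exact ⟨s', _, .ifTrue hlt he, by omega, hq⟩
  · obtain ⟨s', t, he, ht, hq⟩ := h' hlt
    exact ⟨s', _, .ifFalse hlt he, by omega, hq⟩

theorem Program.exec_eval : ∀ {P : Program}, P.isFlat = true → ∀ s,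
    ∃ t, Exec P s (P.eval s) t ∧ t ≤ P.cost := by
  intro P
  induction P with
  | skip => exact fun _ s => ⟨_, .skip s, le_rfl⟩
  | const r c => exact fun _ s => ⟨_, .const r c s, le_rfl⟩
  | copy r a => exact fun _ s => ⟨_, .copy r a s, le_rfl⟩
  | add r a b => exact fun _ s => ⟨_, .add r a b s, le_rfl⟩
  | sub r a b => exact fun _ s => ⟨_, .sub r a b s, le_rfl⟩
  | load r k a => exact fun _ s => ⟨_, .load r k a s, le_rfl⟩
  | store k a b => exact fun _ s => ⟨_, .store k a b s, le_rfl⟩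
  | seq P Q ih₁ ih₂ =>
    intro h s
    simp only [Program.isFlat, Bool.and_eq_true] at h
    obtain ⟨t₁, h₁, ht₁⟩ := ih₁ h.1 s
    obtain ⟨t₂, h₂, ht₂⟩ := ih₂ h.2 (P.eval s)
    exact ⟨_, .seq h₁ h₂, Nat.add_le_add ht₁ ht₂⟩
  | ifLt a b P Q ih₁ ih₂ =>
    intro h s
    simp only [Program.isFlat, Bool.and_eq_true] at h
    obtain ⟨t₁, h₁, ht₁⟩ := ih₁ h.1 s
    obtain ⟨t₂, h₂, ht₂⟩ := ih₂ h.2 s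
    simp only [Program.eval, Program.cost]
    split_ifs with hlt
    · exact ⟨_, .ifTrue hlt h₁, by omega⟩
    · exact ⟨_, .ifFalse hlt h₂, by omega⟩
  | whileLt => exact fun h => by simp [Program.isFlat] at h

theorem ends_flat (hP : P.isFlat = true) (hT : P.cost ≤ T) (h : Q (P.eval s)) : Ends P s T Q := by
  obtain ⟨t, he, ht⟩ := Program.exec_eval hP s
  exact ⟨_, t, he, ht.trans hT, h⟩

/-- The measure bounds the number of iterations, each costing at most `T` steps and one test. The
step may also use that everything the body does not write is unchanged since the loop began. -/
theorem ends_whileLt {a b : ℕ} (I : State → Prop) (μ : State → ℕ)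
    (hstep : ∀ s', Agree P.regs P.arrs s s' → I s' → s'.reg a < s'.reg b →
      Ends P s' T fun s'' => I s'' ∧ μ s'' < μ s')
    (h0 : I s) :
    Ends (.whileLt a b P) s (μ s * (T + 1) + 1) fun s' => I s' ∧ ¬ s'.reg a < s'.reg b := by
  have key : ∀ k s', μ s' ≤ k → Agree P.regs P.arrs s s' → I s' →
      Ends (.whileLt a b P) s' (k * (T + 1) + 1) fun s' => I s' ∧ ¬ s'.reg a < s'.reg b := by
    intro k
    induction k with
    | zero =>
      intro s' hk ha hI
      by_cases hlt : s'.reg a < s'.reg b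
      · obtain ⟨s'', t, he, ht, hI', hμ⟩ := hstep s' ha hI hlt
        omega
      · exact ⟨s', _, .whileFalse hlt, by omega, hI, hlt⟩
    | succ k ih =>
      intro s' hk ha hI
      by_cases hlt : s'.reg a < s'.reg b
      · obtain ⟨s'', t, he, ht, hI', hμ⟩ := hstep s' ha hI hlt
        obtain ⟨s₃, t', he', ht', h⟩ := ih s'' (by omega) (ha.trans he.agree) hI'
        refine ⟨s₃, _, .whileTrue hlt he he', ?_, h⟩
        rw [add_mul]
        omega
      · exact ⟨s', _, .whileFalse hlt, by omega, hI, hlt⟩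
  exact key (μ s) s le_rfl ⟨fun _ _ => rfl, fun _ _ => rfl⟩ h0

/-- Let register `i` run from `0` to the contents of register `b`. Register `4` holds `1`. -/
def forLt (i b : ℕ) (P : Program) : Program :=
  .seq (.const i 0) (.whileLt i b (.seq P (.add i i 4)))

theorem ends_forLt {i b N : ℕ} (I : ℕ → State → Prop) (hN : s.reg b = N) (h1 : s.reg 4 = 1)
    (hi : i ∉ P.regs ∧ b ∉ P.regs ∧ 4 ∉ P.regs ∧ i ≠ b ∧ i ≠ 4)
    (h0 : I 0 (s.setReg i 0))
    (hstep : ∀ k s', k < N → s'.reg i = k → Agree (i :: P.regs) P.arrs s s' → I k s' →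
      Ends P s' T fun s'' => I (k + 1) (s''.setReg i (k + 1))) :
    Ends (forLt i b P) s (N * (T + 2) + 2) (I N) := by
  obtain ⟨hiP, hbP, h4P, hib, hi4⟩ := hi
  have hmem : ∀ r, r ∈ (Program.seq P (.add i i 4)).regs → r ∈ i :: P.regs := by
    intro r hr
    simp only [Program.regs, List.mem_append, List.mem_singleton] at hr
    rcases hr with hr | rfl <;> simp_all
  have hmem' : ∀ k, k ∈ (Program.seq P (.add i i 4)).arrs → k ∈ P.arrs := by
    intro r hr
    simpa [Program.arrs] using hr
  have hA : ∀ {s'}, Agree (i :: P.regs) P.arrs s s' → s'.reg b = N ∧ s'.reg 4 = 1 := by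
    intro s' ha
    exact ⟨(ha.1 b (by simp [hbP, Ne.symm hib])).trans hN,
      (ha.1 4 (by simp [h4P, Ne.symm hi4])).trans h1⟩
  have hs0 : Agree (i :: P.regs) P.arrs s (s.setReg i 0) := agree_setReg (by simp)
  have hw := ends_whileLt (P := .seq P (.add i i 4)) (s := s.setReg i 0) (T := T + 1)
    (a := i) (b := b) (fun s' => I (s'.reg i) s' ∧ s'.reg i ≤ N) (fun s' => N - s'.reg i) ?_
    ⟨by rw [State.setReg_reg, if_pos rfl]; exact h0,
      by rw [State.setReg_reg, if_pos rfl]; exact Nat.zero_le _⟩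
  · obtain ⟨s', t, he, ht, ⟨hI, hle⟩, hlt⟩ := hw
    refine ⟨s', _, .seq (.const i 0 s) he, ?_, ?_⟩
    · rw [State.setReg_reg, if_pos rfl] at ht
      simp only [Nat.sub_zero, add_assoc] at ht
      norm_num at ht
      omega
    · have hb := (hA (hs0.trans (he.agree.mono hmem hmem'))).1
      have : s'.reg i = N := by omega
      rwa [this] at hI
  · rintro s' ha ⟨hI, hle⟩ hlt
    have ha' := hs0.trans (ha.mono hmem hmem')
    have hb := hA ha'
    obtain ⟨s'', t, he, ht, hq⟩ := hstep _ s' (by omega) rfl ha' hI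
    have e1 : s''.reg i = s'.reg i := he.agree.1 _ hiP
    have e4 : s''.reg 4 = 1 := (he.agree.1 _ h4P).trans hb.2
    refine ⟨_, _, .seq he (.add i i 4 s''), by omega, ?_, ?_⟩
    · rw [State.setReg_reg, if_pos rfl, e1, e4]
      exact ⟨hq, by omega⟩
    · rw [State.setReg_reg, if_pos rfl, e1, e4]
      omega

end Machine

/-! ### Codes of trails and the programs that read them -/

section Check

/-- The darts of a graph with `n` nodes and `m` edges: two for each edge, with their tails, heads
and underlying edges. -/
structure Darts where
  n : ℕ
  m : ℕ
  size : ℕ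
  tail : ℕ → ℕ
  head : ℕ → ℕ
  edge : ℕ → ℕ

namespace Darts

variable (δ : Darts) (F : ℕ → ℕ)

/-- The indicator function `F` with the edges of the darts `ds` flipped. -/
def flipped (ds : List ℕ) (e : ℕ) : ℕ := if e ∈ ds.map δ.edge then 1 - F e else F e

/-- The darts form an alternating trail. -/
def Valid : List ℕ → Prop
  | [] => True
  | d :: ds => (δ.edge d ∉ ds.map δ.edge ∧
      ∀ d' ∈ ds.head?, δ.head d = δ.tail d' ∧ F (δ.edge d) ≠ F (δ.edge d')) ∧ Valid ds

/-- Three darts of `F` that form a triangle or have the same tail. -/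
def Bad (d₁ d₂ d₃ : ℕ) : Prop :=
  F (δ.edge d₁) ≠ 0 ∧ F (δ.edge d₂) ≠ 0 ∧ F (δ.edge d₃) ≠ 0 ∧
    ((δ.head d₁ = δ.tail d₂ ∧ δ.head d₂ = δ.tail d₃ ∧ δ.head d₃ = δ.tail d₁) ∨
      (δ.tail d₁ = δ.tail d₂ ∧ δ.tail d₂ = δ.tail d₃ ∧ d₁ < d₂ ∧ d₂ < d₃))

/-- The edges of `F` form a triangle-free 2-matching. -/
def NoBad : Prop := ∀ d₁ < δ.size, ∀ d₂ < δ.size, ∀ d₃ < δ.size, ¬ δ.Bad F d₁ d₂ d₃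

/-- The darts `ds` form an augmenting trail for `F`. -/
def Augments (ds : List ℕ) : Prop :=
  δ.Valid F ds ∧
  ∑ e ∈ Finset.range δ.m, δ.flipped F ds e = ∑ e ∈ Finset.range δ.m, F e + 1 ∧
  δ.NoBad (δ.flipped F ds)

/-- The darts among the first `j` digits of `c` to the base `δ.size + 1`, the last one first. -/
def decode (c : ℕ) : ℕ → List ℕ
  | 0 => []
  | j + 1 => if c / (δ.size + 1) ^ j % (δ.size + 1) < δ.size
      then c / (δ.size + 1) ^ j % (δ.size + 1) :: decode c j else decode c j

/-- The darts are stored in memory. Registers `5` and `7` hold the maximum number of edges of a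
trail and the number of codes of trails. -/
structure Loaded (L W : ℕ) (s : State) : Prop where
  n : s.reg 0 = δ.n
  m : s.reg 1 = δ.m
  one : s.reg 4 = 1
  L : s.reg 5 = L
  size : s.reg 6 = δ.size
  W : s.reg 7 = W
  base : s.reg 8 = δ.size + 1
  passes : s.reg 9 = δ.n + 1
  zero : s.reg 10 = 0
  tail : s.arr 3 = δ.tail
  head : s.arr 4 = δ.head
  edge : s.arr 5 = δ.edge

/-- All stored numbers are in range. -/
structure WF : Prop where
  tail : ∀ d < δ.size, δ.tail d < δ.n
  edge : ∀ d < δ.size, δ.edge d < δ.m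

variable {δ F}

theorem Loaded.agree {L W : ℕ} {s s' : State} {rs as : List ℕ} (h : δ.Loaded L W s)
    (ha : Agree rs as s s') (hr : ∀ r ∈ rs, 10 < r) (has : ∀ k ∈ as, k = 2 ∨ k = 6) :
    δ.Loaded L W s' := by
  have h1 : ∀ r ≤ 10, s'.reg r = s.reg r := fun r hr' => ha.1 r fun hmem => by
    have := hr r hmem
    omega
  have h2 : ∀ k, 3 ≤ k → k ≤ 5 → s'.arr k = s.arr k := fun k h3 h5 => ha.2 k fun hmem => by
    have := has k hmem
    omega
  constructor
  · rw [h1 _ (by omega), h.n]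
  · rw [h1 _ (by omega), h.m]
  · rw [h1 _ (by omega), h.one]
  · rw [h1 _ (by omega), h.L]
  · rw [h1 _ (by omega), h.size]
  · rw [h1 _ (by omega), h.W]
  · rw [h1 _ (by omega), h.base]
  · rw [h1 _ (by omega), h.passes]
  · rw [h1 _ (by omega), h.zero]
  · rw [h2 _ (by omega) (by omega), h.tail]
  · rw [h2 _ (by omega) (by omega), h.head]
  · rw [h2 _ (by omega) (by omega), h.edge]

end Darts

/-- Sequential composition of a list of programs. -/
def block : List Program → Program
  | [] => .skip
  | P :: l => .seq P (block l)

/-- Test for equality of two registers. -/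
def ifEq (a b : ℕ) (P Q : Program) : Program := .ifLt a b Q (.ifLt b a Q P)

theorem eval_block_nil (s : State) : (block []).eval s = s := rfl

theorem eval_block_cons (P : Program) (l : List Program) (s : State) :
    (block (P :: l)).eval s = (block l).eval (P.eval s) := rfl

theorem eval_ifEq (a b : ℕ) (P Q : Program) (s : State) :
    (ifEq a b P Q).eval s = if s.reg a = s.reg b then P.eval s else Q.eval s := by
  simp only [ifEq, Program.eval]
  split_ifs <;> first | rfl | omega

theorem ends_block_cons {P : Program} {l : List Program} {s : State} {T T' T'' : ℕ}
    {Q Q' : State → Prop}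
    (hP : Ends P s T Q') (h : ∀ s', Agree P.regs P.arrs s s' → Q' s' → Ends (block l) s' T' Q)
    (hT : T + T' ≤ T'') : Ends (block (P :: l)) s T'' Q :=
  (Ends.seq (hP.mono le_rfl fun s' ha hq _ => h s' ha hq)).mono hT fun _ _ h => h

theorem ends_block_nil {s : State} {T : ℕ} {Q : State → Prop} (hT : 1 ≤ T) (h : Q s) :
    Ends (block []) s T Q := ⟨s, 1, .skip s, hT, h⟩

/-- Register `14` tells whether `p` holds. -/
def Flag (p : Prop) (s : State) : Prop := (s.reg 14 = 1 ∧ p) ∨ (s.reg 14 = 0 ∧ ¬ p)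

theorem Flag.congr {p q : Prop} {s s' : State} (h : Flag p s) (hs : s'.reg 14 = s.reg 14)
    (hpq : p ↔ q) : Flag q s' := by
  unfold Flag at *
  rwa [hs, ← hpq]

theorem Flag.and {p q : Prop} {s s' : State} [Decidable q] (h : Flag p s)
    (hs : s'.reg 14 = if q then s.reg 14 else 0) : Flag (p ∧ q) s' := by
  unfold Flag at *
  split_ifs at hs <;> rw [hs] <;> tauto

/-- Divide register `19` by register `8`, with remainder in register `18`. -/
def divProg : Program := block
  -- Register `6` holds one less than the divisor in register `8`, so this strict test means that
  -- the divisor can still be subtracted.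
  [.copy 18 19, .const 19 0, .whileLt 6 18 (block [.sub 18 18 8, .add 19 19 4])]

theorem ends_divProg {s : State} {D Y : ℕ} (h6 : s.reg 6 = D) (h8 : s.reg 8 = D + 1)
    (h4 : s.reg 4 = 1) (hY : s.reg 19 = Y) :
    Ends divProg s (4 * Y + 5) fun s' =>
      s'.reg 18 = Y % (D + 1) ∧ s'.reg 19 = Y / (D + 1) := by
  refine ends_block_cons (T := 1) (ends_flat (Q := fun s' => s' = s.setReg 18 Y) rfl le_rfl
    (by simp [Program.eval, hY])) ?_ (T' := 4 * Y + 4) (by omega)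
  rintro _ - rfl
  refine ends_block_cons (T := 1) (ends_flat (Q := fun s' => s' = (s.setReg 18 Y).setReg 19 0)
    rfl le_rfl (by simp [Program.eval])) ?_ (T' := 4 * Y + 3) (by omega)
  rintro _ - rfl
  refine ends_block_cons (ends_whileLt (T := 3) (fun s' => s'.reg 18 + (D + 1) * s'.reg 19 = Y)
    (fun s' => s'.reg 18) ?_ (by simp [State.setReg_reg])) ?_ (T' := 1)
    (by simp [State.setReg_reg]; omega)
  · intro s' ha hI hlt
    have e6 : s'.reg 6 = D := (ha.1 6 (by decide)).trans (by simp [State.setReg_reg, h6])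
    have e8 : s'.reg 8 = D + 1 := (ha.1 8 (by decide)).trans (by simp [State.setReg_reg, h8])
    have e4 : s'.reg 4 = 1 := (ha.1 4 (by decide)).trans (by simp [State.setReg_reg, h4])
    refine ends_flat rfl le_rfl ?_
    simp only [eval_block_cons, eval_block_nil, Program.eval, State.setReg_reg, e8, e4]
    norm_num
    rw [mul_add, mul_one]
    omega
  · rintro s' ha ⟨hI, hlt⟩
    have e6 : s'.reg 6 = D := (ha.1 6 (by decide)).trans (by simp [State.setReg_reg, h6])
    refine ends_block_nil le_rfl ?_
    have hlt : s'.reg 18 < D + 1 := by omega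
    rw [← hI, Nat.add_mul_mod_self_left, Nat.mod_eq_of_lt hlt, Nat.add_mul_div_left _ _ (by omega),
      Nat.div_eq_of_lt hlt, zero_add]
    exact ⟨rfl, rfl⟩

/-- Put the dart in register `18` in front of the current trail. -/
def pushProg : Program := block
  [.load 23 5 18, .load 24 2 23, .load 25 6 23, .load 26 4 18, .load 27 3 18,
    -- The original set and the flipped copy agree on an edge exactly when the trail has not used it
    -- yet.
    ifEq 24 25 .skip (.const 14 0),
    -- The number of nodes, which is not a node, stands for the missing first node of the empty
    -- trail. Likewise the colour `2` in the next test.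
    ifEq 26 15 .skip (ifEq 15 0 .skip (.const 14 0)),
    ifEq 24 16 (.const 14 0) .skip,
    .copy 15 27, .copy 16 24, .sub 25 4 24, .store 6 23 25]

theorem eval_pushProg (s : State) (h4 : s.reg 4 = 1) :
    (pushProg.eval s).reg 14 = (if s.arr 2 (s.arr 5 (s.reg 18)) = s.arr 6 (s.arr 5 (s.reg 18)) ∧
      (s.arr 4 (s.reg 18) = s.reg 15 ∨ s.reg 15 = s.reg 0) ∧
      s.arr 2 (s.arr 5 (s.reg 18)) ≠ s.reg 16 then s.reg 14 else 0) ∧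
    (pushProg.eval s).reg 15 = s.arr 3 (s.reg 18) ∧
    (pushProg.eval s).reg 16 = s.arr 2 (s.arr 5 (s.reg 18)) ∧
    (pushProg.eval s).arr 6 = Function.update (s.arr 6) (s.arr 5 (s.reg 18))
      (1 - s.arr 2 (s.arr 5 (s.reg 18))) := by
  simp only [pushProg, eval_block_cons, eval_block_nil, eval_ifEq, Program.eval]
  by_cases c1 : s.arr 2 (s.arr 5 (s.reg 18)) = s.arr 6 (s.arr 5 (s.reg 18)) <;>
  by_cases c2 : s.arr 4 (s.reg 18) = s.reg 15 <;>
  by_cases c3 : s.reg 15 = s.reg 0 <;>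
  by_cases c4 : s.arr 2 (s.arr 5 (s.reg 18)) = s.reg 16 <;>
  simp [State.setReg_reg, State.setReg_arr, State.setArr_reg, State.setArr_arr, c1, c2, c3, c4, h4] <;>
  simp_all [State.setReg_reg, State.setReg_arr]

end Check

/-! ### Correctness of the individual tests -/

section CheckSpec

variable {δ : Darts} {F : ℕ → ℕ}

/-- The memory describes the trail `ds`: register `14` tells whether it is valid, register `15`
holds its first node, register `16` tells whether its first edge belongs to `F`, and array `6`
holds the flipped set. -/
structure Darts.Tracks (δ : Darts) (F : ℕ → ℕ) (ds : List ℕ) (s : State) : Prop where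
  flag : Flag (δ.Valid F ds) s
  flipped : δ.Valid F ds → ∀ e < δ.m, s.arr 6 e = δ.flipped F ds e
  tail : s.reg 15 = ds.head?.elim δ.n δ.tail
  color : s.reg 16 = ds.head?.elim 2 fun d => F (δ.edge d)

theorem Darts.Tracks.push {L W d : ℕ} {ds : List ℕ} {s : State} (hδ : δ.WF)
    (h : δ.Tracks F ds s) (hL : δ.Loaded L W s) (hs : s.arr 2 = F) (hF : ∀ e < δ.m, F e ≤ 1)
    (hd : d < δ.size) (hds : ∀ d ∈ ds, d < δ.size) (h18 : s.reg 18 = d) :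
    δ.Tracks F (d :: ds) (pushProg.eval s) := by
  obtain ⟨h14, h15, h16, h6⟩ := eval_pushProg s hL.one
  simp only [h18, hs, hL.tail, hL.head, hL.edge, hL.n, h.tail, h.color] at h14 h15 h16 h6
  have hem := hδ.edge d hd
  have hFd := hF _ hem
  have key : δ.Valid F ds → ((F (δ.edge d) = s.arr 6 (δ.edge d) ∧
      (δ.head d = ds.head?.elim δ.n δ.tail ∨ ds.head?.elim δ.n δ.tail = δ.n) ∧
      F (δ.edge d) ≠ ds.head?.elim 2 fun d => F (δ.edge d)) ↔
      (δ.edge d ∉ ds.map δ.edge ∧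
      ∀ d' ∈ ds.head?, δ.head d = δ.tail d' ∧ F (δ.edge d) ≠ F (δ.edge d'))) := by
    intro hv
    rw [h.flipped hv _ hem, Darts.flipped]
    have h1 : (F (δ.edge d) = if δ.edge d ∈ ds.map δ.edge then 1 - F (δ.edge d)
        else F (δ.edge d)) ↔ δ.edge d ∉ ds.map δ.edge := by
      split_ifs with hmem
      · simp only [hmem, not_true_eq_false, iff_false]
        omega
      · simp [hmem]
    rw [h1]
    refine and_congr_right fun _ => ?_
    rcases ds with _ | ⟨d', ds⟩
    · simp
      omega
    · have := hδ.tail d' (hds d' (by simp))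
      simp only [List.head?_cons, Option.elim_some, Option.mem_def, Option.some.injEq,
        forall_eq']
      have : δ.tail d' ≠ δ.n := by omega
      tauto
  refine ⟨?_, fun hv e he => ?_, by simpa using h15, by simpa using h16⟩
  · have h' := h.flag.and h14
    refine h'.congr rfl ?_
    rw [Darts.Valid, and_comm (b := δ.Valid F ds)]
    exact and_congr_right key
  · rw [Darts.Valid] at hv
    rw [h6, Function.update_apply, h.flipped hv.2 e he, Darts.flipped, Darts.flipped]
    rcases eq_or_ne e (δ.edge d) with rfl | hne
    · simp
    · simp [hne]

theorem Darts.decode_lt {c j : ℕ} : ∀ d ∈ δ.decode c j, d < δ.size := by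
  induction j with
  | zero => simp [Darts.decode]
  | succ j ih =>
    rw [Darts.decode]
    split_ifs with h
    · simpa [h] using ih
    · exact ih

/-- Extract a digit and process it. -/
def stepProg : Program := block [divProg, .ifLt 18 6 pushProg .skip]

theorem ends_trail {L W c : ℕ} {s : State} (hδ : δ.WF) (hL : δ.Loaded L W s) (hs : s.arr 2 = F)
    (hF : ∀ e < δ.m, F e ≤ 1) (hc : c < W) (h19 : s.reg 19 = c) (h : δ.Tracks F [] s) :
    Ends (forLt 13 5 stepProg) s (L * (4 * W + 70) + 2) (δ.Tracks F (δ.decode c L)) := by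
  refine (ends_forLt (T := 4 * W + 68) (fun j s' => s'.reg 19 = c / (δ.size + 1) ^ j ∧
    δ.Tracks F (δ.decode c j) s') hL.L hL.one (by decide) ?_ ?_).mono le_rfl fun _ _ h => h.2
  · refine ⟨by simp [State.setReg_reg, h19], ?_⟩
    refine ⟨?_, fun hv => h.flipped hv, ?_, ?_⟩
    · exact h.flag.congr (by simp [State.setReg_reg]) Iff.rfl
    · rw [State.setReg_reg, if_neg (by omega), h.tail]; rfl
    · rw [State.setReg_reg, if_neg (by omega), h.color]; rfl
  · rintro j s' hj - ha ⟨h19', ht⟩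
    have hL' := hL.agree ha (by decide) (by decide)
    have hs' : s'.arr 2 = F := (ha.2 2 (by decide)).trans hs
    have hle : c / (δ.size + 1) ^ j ≤ c := Nat.div_le_self _ _
    refine ends_block_cons (ends_divProg hL'.size hL'.base hL'.one h19') ?_
      (T' := 63) (by omega)
    rintro s₁ ha₁ ⟨h18, h19₁⟩
    have hL₁ := hL'.agree ha₁ (by decide) (by decide)
    have hs₁ : s₁.arr 2 = F := (ha₁.2 2 (by decide)).trans hs'
    have ht₁ : δ.Tracks F (δ.decode c j) s₁ := by
      refine ⟨ht.flag.congr (ha₁.1 14 (by decide)) Iff.rfl, ?_, ?_, ?_⟩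
      · rw [ha₁.2 6 (by decide)]
        exact ht.flipped
      · rw [ha₁.1 15 (by decide)]
        exact ht.tail
      · rw [ha₁.1 16 (by decide)]
        exact ht.color
    refine ends_flat rfl (by decide) ?_
    simp only [eval_block_cons, eval_block_nil, Program.eval, hL₁.size, h18]
    set x := c / (δ.size + 1) ^ j % (δ.size + 1) with hx
    have aux : ∀ {ds s₂}, δ.Tracks F ds s₂ → δ.Tracks F ds (s₂.setReg 13 (j + 1)) := by
      intro ds s₂ ht₂
      refine ⟨ht₂.flag.congr (by simp [State.setReg_reg]) Iff.rfl, ht₂.flipped, ?_, ?_⟩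
      · rw [State.setReg_reg, if_neg (by omega), ht₂.tail]
      · rw [State.setReg_reg, if_neg (by omega), ht₂.color]
    have e : c / (δ.size + 1) ^ (j + 1) = c / (δ.size + 1) ^ j / (δ.size + 1) := by
      rw [Nat.div_div_eq_div_mul, pow_succ]
    rw [Darts.decode, e]
    split_ifs with hlt
    · refine ⟨?_, aux (ht₁.push hδ hL₁ hs₁ hF hlt Darts.decode_lt h18)⟩
      have := (Program.exec_eval (P := pushProg) rfl s₁)
      obtain ⟨t, he, -⟩ := this
      rw [State.setReg_reg, if_neg (by omega), he.agree.1 19 (by decide), h19₁]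
    · exact ⟨by rw [State.setReg_reg, if_neg (by omega), h19₁], aux ht₁⟩

/-- Compare the sizes of the sets in arrays `2` and `6`. -/
def sizeProg : Program := block
  -- Starting the first sum at `1` turns the required gain of one edge into an equality test.
  [.const 20 1, .const 21 0,
    forLt 17 1 (block [.load 23 2 17, .add 20 20 23, .load 23 6 17, .add 21 21 23]),
    ifEq 20 21 .skip (.const 14 0)]

theorem ends_sizeProg {L W : ℕ} {s : State} (hL : δ.Loaded L W s) {p : Prop} (hp : Flag p s) :
    Ends sizeProg s (7 * δ.m + 20) (Flag (p ∧ ∑ e ∈ Finset.range δ.m, s.arr 6 e =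
      ∑ e ∈ Finset.range δ.m, s.arr 2 e + 1)) := by
  refine ends_block_cons (T := 1) (ends_flat (Q := fun s' => s' = s.setReg 20 1) rfl le_rfl
    rfl) ?_ (T' := 7 * δ.m + 19) (by omega)
  rintro _ - rfl
  refine ends_block_cons (T := 1) (ends_flat (Q := fun s' => s' = (s.setReg 20 1).setReg 21 0)
    rfl le_rfl rfl) ?_ (T' := 7 * δ.m + 18) (by omega)
  rintro _ - rfl
  refine ends_block_cons (ends_forLt (T := 5) (N := δ.m) (fun k s' =>
    s'.reg 20 = ∑ e ∈ Finset.range k, s.arr 2 e + 1 ∧ s'.reg 21 = ∑ e ∈ Finset.range k, s.arr 6 e)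
    (by simp [State.setReg_reg, hL.m]) (by simp [State.setReg_reg, hL.one]) (by decide)
    (by simp [State.setReg_reg]) ?_) ?_ (T' := 15) (by omega)
  · rintro k s' hk h17 ha ⟨h20, h21⟩
    refine ends_flat rfl le_rfl ?_
    have e2 : s'.arr 2 = s.arr 2 := ha.2 2 (by decide)
    have e6 : s'.arr 6 = s.arr 6 := ha.2 6 (by decide)
    simp only [eval_block_cons, eval_block_nil, Program.eval, State.setReg_reg, State.setReg_arr,
      Finset.sum_range_succ, e2, e6, h17]
    norm_num
    omega
  · rintro s' ha ⟨h20, h21⟩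
    refine ends_flat rfl (by decide) ?_
    have e14 : s'.reg 14 = s.reg 14 := (ha.1 14 (by decide)).trans (by simp [State.setReg_reg])
    refine hp.and ?_
    simp only [eval_block_cons, eval_block_nil, eval_ifEq, Program.eval]
    rw [h20, h21, ← e14]
    by_cases h : ∑ e ∈ Finset.range δ.m, s.arr 6 e = ∑ e ∈ Finset.range δ.m, s.arr 2 e + 1
    · simp [h]
    · rw [if_neg h, if_neg (Ne.symm h)]
      simp [State.setReg_reg]

/-- Clear register `14` if the darts described by registers `26` to `31` form a triangle. -/
def triangleProg : Program :=
  ifEq 29 27 (ifEq 30 28 (ifEq 31 26 (.const 14 0) .skip) .skip) .skip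

theorem eval_triangleProg (s : State) : triangleProg.eval s =
    if s.reg 29 = s.reg 27 ∧ s.reg 30 = s.reg 28 ∧ s.reg 31 = s.reg 26 then s.setReg 14 0
    else s := by
  simp only [triangleProg, eval_ifEq, Program.eval]
  split_ifs <;> first | rfl | tauto

/-- Clear register `14` if the distinct darts in registers `20` to `22` have the same tail. -/
def starProg : Program :=
  ifEq 26 27 (ifEq 27 28 (.ifLt 20 21 (.ifLt 21 22 (.const 14 0) .skip) .skip) .skip) .skip

theorem eval_starProg (s : State) : starProg.eval s =
    if s.reg 26 = s.reg 27 ∧ s.reg 27 = s.reg 28 ∧ s.reg 20 < s.reg 21 ∧ s.reg 21 < s.reg 22 then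
      s.setReg 14 0 else s := by
  simp only [starProg, eval_ifEq, Program.eval]
  split_ifs <;> first | rfl | tauto

/-- Load the data of the darts in registers `20`, `21`, `22`. -/
def loadProg : Program := block
  [.load 23 5 20, .load 23 6 23, .load 24 5 21, .load 24 6 24, .load 25 5 22, .load 25 6 25,
    .load 26 3 20, .load 27 3 21, .load 28 3 22, .load 29 4 20, .load 30 4 21, .load 31 4 22]

/-- Clear register `14` if the darts in registers `20`, `21`, `22` are bad. -/
def badProg : Program := block [loadProg, .ifLt 10 23 (.ifLt 10 24 (.ifLt 10 25
  (block [triangleProg, starProg]) .skip) .skip) .skip]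

open Classical in
theorem eval_badProg {L W d₁ d₂ d₃ : ℕ} {s : State} (hL : δ.Loaded L W s) (h₁ : s.reg 20 = d₁)
    (h₂ : s.reg 21 = d₂) (h₃ : s.reg 22 = d₃) :
    (badProg.eval s).reg 14 = if ¬ δ.Bad (s.arr 6) d₁ d₂ d₃ then s.reg 14 else 0 := by
  have hl : ∀ r, (loadProg.eval s).reg r = if r = 23 then s.arr 6 (δ.edge d₁) else
      if r = 24 then s.arr 6 (δ.edge d₂) else if r = 25 then s.arr 6 (δ.edge d₃) else
      if r = 26 then δ.tail d₁ else if r = 27 then δ.tail d₂ else if r = 28 then δ.tail d₃ else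
      if r = 29 then δ.head d₁ else if r = 30 then δ.head d₂ else if r = 31 then δ.head d₃ else
      s.reg r := by
    intro r
    simp only [loadProg, eval_block_cons, eval_block_nil, Program.eval, State.setReg_reg,
      State.setReg_arr, h₁, h₂, h₃, hL.tail, hL.head, hL.edge]
    norm_num
    split_ifs <;> first | rfl | omega
  simp only [badProg, eval_block_cons, eval_block_nil, Program.eval]
  generalize loadProg.eval s = s₁ at hl
  have e10 : s₁.reg 10 = 0 := by rw [hl]; simp [hL.zero]
  have e14 : s₁.reg 14 = s.reg 14 := by rw [hl]; simp
  have e20 : s₁.reg 20 = d₁ := by rw [hl]; simp [h₁]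
  have e21 : s₁.reg 21 = d₂ := by rw [hl]; simp [h₂]
  have e22 : s₁.reg 22 = d₃ := by rw [hl]; simp [h₃]
  have e23 : s₁.reg 23 = s.arr 6 (δ.edge d₁) := by rw [hl]; simp
  have e24 : s₁.reg 24 = s.arr 6 (δ.edge d₂) := by rw [hl]; simp
  have e25 : s₁.reg 25 = s.arr 6 (δ.edge d₃) := by rw [hl]; simp
  have e26 : s₁.reg 26 = δ.tail d₁ := by rw [hl]; simp
  have e27 : s₁.reg 27 = δ.tail d₂ := by rw [hl]; simp
  have e28 : s₁.reg 28 = δ.tail d₃ := by rw [hl]; simp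
  have e29 : s₁.reg 29 = δ.head d₁ := by rw [hl]; simp
  have e30 : s₁.reg 30 = δ.head d₂ := by rw [hl]; simp
  have e31 : s₁.reg 31 = δ.head d₃ := by rw [hl]; simp
  rw [eval_starProg, eval_triangleProg]
  simp only [e10, e23, e24, e25, e29, e27, e30, e28, e31, e26, Nat.pos_iff_ne_zero]
  by_cases c1 : s.arr 6 (δ.edge d₁) ≠ 0
  swap
  · rw [if_neg c1, if_pos fun h => c1 h.1, e14]
  by_cases c2 : s.arr 6 (δ.edge d₂) ≠ 0
  swap
  · rw [if_pos c1, if_neg c2, if_pos fun h => c2 h.2.1, e14]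
  by_cases c3 : s.arr 6 (δ.edge d₃) ≠ 0
  swap
  · rw [if_pos c1, if_pos c2, if_neg c3, if_pos fun h => c3 h.2.2.1, e14]
  rw [if_pos c1, if_pos c2, if_pos c3]
  clear hl
  by_cases c4 : δ.head d₁ = δ.tail d₂ ∧ δ.head d₂ = δ.tail d₃ ∧ δ.head d₃ = δ.tail d₁
  · rw [if_pos c4, if_neg (not_not.2 ⟨c1, c2, c3, .inl c4⟩)]
    split_ifs <;> simp [State.setReg_reg]
  · rw [if_neg c4, e26, e27, e28, e20, e21, e22]
    by_cases c5 : δ.tail d₁ = δ.tail d₂ ∧ δ.tail d₂ = δ.tail d₃ ∧ d₁ < d₂ ∧ d₂ < d₃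
    · rw [if_pos c5, if_neg (not_not.2 ⟨c1, c2, c3, .inr c5⟩)]
      simp [State.setReg_reg]
    · rw [if_neg c5, if_pos fun h => h.2.2.2.elim c4 c5, e14]

/-- Clear register `14` if there are bad darts. -/
def noBadProg : Program := forLt 20 6 (forLt 21 6 (forLt 22 6 badProg))

theorem ends_noBadProg {L W : ℕ} {s : State} (hL : δ.Loaded L W s) {p : Prop} (hp : Flag p s) :
    Ends noBadProg s (δ.size * (δ.size * (δ.size * 52 + 4) + 4) + 2)
      (Flag (p ∧ δ.NoBad (s.arr 6))) := by
  have aux : ∀ {q : Prop} {s' : State} {r x : ℕ}, r ≠ 14 → Flag q s' → Flag q (s'.setReg r x) := by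
    intro q s' r x hr h
    exact h.congr (by rw [State.setReg_reg, if_neg hr.symm]) Iff.rfl
  refine (ends_forLt (T := δ.size * (δ.size * 52 + 4) + 2) (N := δ.size) (fun k s' => Flag (p ∧
    ∀ d₁ < k, ∀ d₂ < δ.size, ∀ d₃ < δ.size, ¬ δ.Bad (s.arr 6) d₁ d₂ d₃) s')
    hL.size hL.one (by decide) (aux (by decide) (by simpa using hp)) ?_).mono le_rfl
    fun _ _ h => h
  intro d₁ s₁ hd₁ hr₁ ha₁ hf₁
  have hL₁ := hL.agree ha₁ (by decide) (by decide)
  refine (ends_forLt (T := δ.size * 52 + 2) (N := δ.size) (fun k s' => Flag ((p ∧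
    ∀ x < d₁, ∀ y < δ.size, ∀ z < δ.size, ¬ δ.Bad (s.arr 6) x y z) ∧
    ∀ d₂ < k, ∀ d₃ < δ.size, ¬ δ.Bad (s.arr 6) d₁ d₂ d₃) s')
    hL₁.size hL₁.one (by decide) (aux (by decide) (by simpa using hf₁)) ?_).mono le_rfl ?_
  swap
  · rintro s' - h
    refine aux (by decide) (h.congr rfl ?_)
    simp only [Nat.lt_succ_iff_lt_or_eq, or_imp, forall_and, forall_eq, and_assoc]
  intro d₂ s₂ hd₂ hr₂ ha₂ hf₂
  have hL₂ := hL₁.agree ha₂ (by decide) (by decide)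
  refine (ends_forLt (T := 50) (N := δ.size) (fun k s' => Flag (((p ∧
    ∀ x < d₁, ∀ y < δ.size, ∀ z < δ.size, ¬ δ.Bad (s.arr 6) x y z) ∧
    ∀ y < d₂, ∀ z < δ.size, ¬ δ.Bad (s.arr 6) d₁ y z) ∧
    ∀ d₃ < k, ¬ δ.Bad (s.arr 6) d₁ d₂ d₃) s')
    hL₂.size hL₂.one (by decide) (aux (by decide) (by simpa using hf₂)) ?_).mono le_rfl ?_
  swap
  · rintro s' - h
    refine aux (by decide) (h.congr rfl ?_)
    simp only [Nat.lt_succ_iff_lt_or_eq, or_imp, forall_and, forall_eq, and_assoc]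
  intro d₃ s₃ hd₃ hr₃ ha₃ hf₃
  have hL₃ := hL₂.agree ha₃ (by decide) (by decide)
  have e20 : s₃.reg 20 = d₁ := by
    rw [ha₃.1 20 (by decide), ha₂.1 20 (by decide), hr₁]
  have e21 : s₃.reg 21 = d₂ := by rw [ha₃.1 21 (by decide), hr₂]
  have e6 : s₃.arr 6 = s.arr 6 := by
    rw [ha₃.2 6 (by decide), ha₂.2 6 (by decide), ha₁.2 6 (by decide)]
  refine ends_flat rfl (by decide) (aux (by decide) ?_)
  classical
  refine (hf₃.and (eval_badProg hL₃ e20 e21 hr₃)).congr rfl ?_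
  rw [e6]
  simp only [Nat.lt_succ_iff_lt_or_eq, or_imp, forall_and, forall_eq, and_assoc]

end CheckSpec

/-! ### Testing one code, and every short dart list having a code -/

section CheckProgram

variable {δ : Darts} {F : ℕ → ℕ}

theorem Darts.noBad_congr (hδ : δ.WF) {F' : ℕ → ℕ} (h : ∀ e < δ.m, F e = F' e) :
    δ.NoBad F ↔ δ.NoBad F' := by
  refine forall₂_congr fun d₁ h₁ => forall₂_congr fun d₂ h₂ => forall₂_congr fun d₃ h₃ => ?_
  rw [Darts.Bad, Darts.Bad, h _ (hδ.edge _ h₁), h _ (hδ.edge _ h₂), h _ (hδ.edge _ h₃)]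

/-- Copy the first cells of array `a` to array `b`, one for each edge. -/
def copyProg (a b : ℕ) : Program := forLt 17 1 (block [.load 23 a 17, .store b 17 23])

theorem ends_copyProg {L W a b : ℕ} (hab : a ≠ b) {s : State} (hL : δ.Loaded L W s) :
    Ends (copyProg a b) s (δ.m * 5 + 2) fun s' => ∀ e < δ.m, s'.arr b e = s.arr a e := by
  refine (ends_forLt (T := 3) (N := δ.m) (fun k s' => ∀ e < k, s'.arr b e = s.arr a e)
    hL.m hL.one (by simp [block, Program.regs]) (by simp) ?_).mono le_rfl fun _ _ h => h
  intro k s' hk h17 ha hI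
  refine ends_flat rfl le_rfl ?_
  have ea : s'.arr a = s.arr a := ha.2 a (by simp [block, Program.arrs, hab])
  intro e he
  simp only [eval_block_cons, eval_block_nil, Program.eval, State.setReg_arr, State.setArr_arr,
    State.setReg_reg, h17, ea, if_pos, Function.update_apply]
  norm_num
  split_ifs with h
  · rw [h]
  · exact hI e (by omega)

/-- Test whether the code in register `12` describes an augmenting trail, and flip it if so. -/
def checkProg : Program := block
  [copyProg 2 6, block [.const 14 1, .copy 15 0, .const 16 2, .copy 19 12], forLt 13 5 stepProg,
    sizeProg, noBadProg, .ifLt 10 14 (copyProg 6 2) .skip]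

/-- A bound on the time for one check. -/
def checkTime (δ : Darts) (L W : ℕ) : ℕ :=
  L * (4 * W + 70) + δ.m * 17 + δ.size * (δ.size * (δ.size * 52 + 4) + 4) + 50

theorem ends_checkProg {L W c : ℕ} {s : State} (hδ : δ.WF) (hL : δ.Loaded L W s)
    (hs : s.arr 2 = F) (hF : ∀ e < δ.m, F e ≤ 1) (hc : c < W) (h12 : s.reg 12 = c) :
    Ends checkProg s (checkTime δ L W) fun s' =>
      (¬ δ.Augments F (δ.decode c L) ∧ s'.arr 2 = F) ∨
      (δ.Augments F (δ.decode c L) ∧ ∀ e < δ.m, s'.arr 2 e = δ.flipped F (δ.decode c L) e) := by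
  refine ends_block_cons (ends_copyProg (by decide) hL) ?_ (T' := checkTime δ L W - (δ.m * 5 + 2))
    (by unfold checkTime; omega)
  intro s₁ ha₁ h6₁
  have hL₁ := hL.agree ha₁ (by decide) (by decide)
  have hs₁ : s₁.arr 2 = F := (ha₁.2 2 (by decide)).trans hs
  have h12₁ : s₁.reg 12 = c := (ha₁.1 12 (by decide)).trans h12
  refine ends_block_cons (T := 5) (Q' := fun s' => s'.reg 19 = c ∧ δ.Tracks F [] s')
    (ends_flat rfl le_rfl ?_) ?_ (T' := checkTime δ L W - (δ.m * 5 + 7))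
    (by unfold checkTime; omega)
  · simp only [eval_block_cons, eval_block_nil, Program.eval, State.setReg_reg]
    refine ⟨by simp [h12₁], .inl ⟨by simp [State.setReg_reg], trivial⟩,
      fun _ e he => ?_, by simp [State.setReg_reg, hL₁.n], by simp [State.setReg_reg]⟩
    simp [State.setReg_arr, h6₁ e he, hs, Darts.flipped]
  rintro s₂ ha₂ ⟨h19, ht⟩
  have hL₂ := hL₁.agree ha₂ (by decide) (by decide)
  have hs₂ : s₂.arr 2 = F := (ha₂.2 2 (by decide)).trans hs₁
  refine ends_block_cons (ends_trail hδ hL₂ hs₂ hF hc h19 ht) ?_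
    (T' := δ.m * 12 + δ.size * (δ.size * (δ.size * 52 + 4) + 4) + 41)
    (by unfold checkTime; omega)
  intro s₃ ha₃ ht₃
  have hL₃ := hL₂.agree ha₃ (by decide) (by decide)
  have hs₃ : s₃.arr 2 = F := (ha₃.2 2 (by decide)).trans hs₂
  refine ends_block_cons (ends_sizeProg hL₃ ht₃.flag) ?_
    (T' := δ.m * 5 + δ.size * (δ.size * (δ.size * 52 + 4) + 4) + 21) (by omega)
  intro s₄ ha₄ hf₄
  have hL₄ := hL₃.agree ha₄ (by decide) (by decide)
  have hs₄ : s₄.arr 2 = F := (ha₄.2 2 (by decide)).trans hs₃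
  refine ends_block_cons (ends_noBadProg hL₄ hf₄) ?_ (T' := δ.m * 5 + 19) (by omega)
  intro s₅ ha₅ hf₅
  have hL₅ := hL₄.agree ha₅ (by decide) (by decide)
  have hs₅ : s₅.arr 2 = F := (ha₅.2 2 (by decide)).trans hs₄
  have h64 : s₄.arr 6 = s₃.arr 6 := ha₄.2 6 (by decide)
  have h65 : s₅.arr 6 = s₃.arr 6 := (ha₅.2 6 (by decide)).trans h64
  -- Array `6` is known to hold the flipped set only if the trail is valid, so the last two tests
  -- are interpreted under that assumption; otherwise the flag is already cleared.
  have hf : Flag (δ.Augments F (δ.decode c L)) s₅ := by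
    refine hf₅.congr rfl ?_
    rw [and_assoc]
    refine and_congr_right fun hv => ?_
    have h6 := ht₃.flipped hv
    rw [h64, hs₃, Finset.sum_congr rfl fun e he => h6 e (Finset.mem_range.1 he),
      Darts.noBad_congr hδ h6]
  refine ends_block_cons (T := δ.m * 5 + 3) (ends_ifLt (T := δ.m * 5 + 2)
    (Q := fun s' => (¬ δ.Augments F (δ.decode c L) ∧ s'.arr 2 = F) ∨
      (δ.Augments F (δ.decode c L) ∧ ∀ e < δ.m, s'.arr 2 e = δ.flipped F (δ.decode c L) e))
    ?_ ?_) ?_ (T' := 1) (by omega)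
  · intro hlt
    have hA : δ.Augments F (δ.decode c L) := by
      rcases hf with ⟨-, h⟩ | ⟨h, -⟩
      · exact h
      · omega
    refine (ends_copyProg (by decide) hL₅).mono le_rfl fun s' _ h => .inr ⟨hA, fun e he => ?_⟩
    rw [h e he, h65, ht₃.flipped hA.1 e he]
  · intro hlt
    have hA : ¬ δ.Augments F (δ.decode c L) := by
      rcases hf with ⟨h, -⟩ | ⟨-, h⟩
      · exact absurd (by rw [hL₅.zero, h]; exact one_pos) hlt
      · exact h
    exact ends_flat rfl (by simp [Program.cost]) (.inl ⟨hA, hs₅⟩)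
  · exact fun s' _ h => ends_block_nil le_rfl h

theorem Darts.decode_mod {c j : ℕ} {k : ℕ} (hk : j ≤ k) :
    δ.decode (c % (δ.size + 1) ^ k) j = δ.decode c j := by
  induction j with
  | zero => rfl
  | succ j ih =>
    have : c % (δ.size + 1) ^ k / (δ.size + 1) ^ j % (δ.size + 1) =
        c / (δ.size + 1) ^ j % (δ.size + 1) := by
      obtain ⟨i, rfl⟩ := Nat.exists_eq_add_of_le hk
      rw [show j + 1 + i = j + (i + 1) by omega, pow_add, Nat.mod_mul_right_div_self, pow_succ,
        Nat.mod_mul_left_mod]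
    rw [Darts.decode, Darts.decode, this, ih (by omega)]

/-- The digit `δ.size` is a blank. A list shorter than `L` is padded by blank leading digits; for
full length the head of the list is the leading digit. -/
theorem Darts.exists_decode {L : ℕ} {ds : List ℕ} (h : ∀ d ∈ ds, d < δ.size)
    (hl : ds.length ≤ L) : ∃ c < (δ.size + 1) ^ L, δ.decode c L = ds := by
  have key : ∀ x ≤ δ.size, ∀ {L c : ℕ}, c < (δ.size + 1) ^ L →
      c + x * (δ.size + 1) ^ L < (δ.size + 1) ^ (L + 1) ∧
      δ.decode (c + x * (δ.size + 1) ^ L) (L + 1) =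
        if x < δ.size then x :: δ.decode c L else δ.decode c L := by
    intro x hx L c hc
    constructor
    · rw [pow_succ]
      nlinarith
    · have h1 : (c + x * (δ.size + 1) ^ L) / (δ.size + 1) ^ L = x := by
        rw [Nat.add_mul_div_right _ _ (by positivity), Nat.div_eq_of_lt hc, zero_add]
      have h2 : δ.decode (c + x * (δ.size + 1) ^ L) L = δ.decode c L := by
        rw [← Darts.decode_mod le_rfl, Nat.add_mul_mod_self_right, Darts.decode_mod le_rfl]
      rw [Darts.decode, h1, h2, Nat.mod_eq_of_lt (by omega)]
  induction L generalizing ds with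
  | zero =>
    rw [List.eq_nil_of_length_eq_zero (by omega : ds.length = 0)]
    exact ⟨0, by simp, rfl⟩
  | succ L ih =>
    by_cases hlen : ds.length ≤ L
    · obtain ⟨c, hc, hd⟩ := ih h hlen
      obtain ⟨h1, h2⟩ := key δ.size le_rfl hc
      exact ⟨_, h1, by rw [h2, if_neg (lt_irrefl _), hd]⟩
    · rcases ds with _ | ⟨d, ds⟩
      · simp at hlen
      · obtain ⟨c, hc, hd⟩ := ih (ds := ds) (fun x hx => h x (by simp [hx]))
          (by simpa using hl)
        have hlt := h d (by simp)
        obtain ⟨h1, h2⟩ := key d hlt.le hc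
        exact ⟨_, h1, by rw [h2, if_pos hlt, hd]⟩

end CheckProgram

/-! ### Preparing the memory -/

section Init

variable {n : ℕ}

/-- The darts are those of the listed edges: first one dart for each edge, then the reversed
darts. -/
structure Darts.Represents (δ : Darts) (l : List (Fin n × Fin n)) : Prop where
  n : δ.n = n
  m : δ.m = l.length
  size : δ.size = l.length + l.length
  tail : ∀ i (h : i < l.length), δ.tail i = l[i].1
  head : ∀ i (h : i < l.length), δ.head i = l[i].2
  edge : ∀ i < l.length, δ.edge i = i
  tail' : ∀ i (h : i < l.length), δ.tail (l.length + i) = l[i].2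
  head' : ∀ i (h : i < l.length), δ.head (l.length + i) = l[i].1
  edge' : ∀ i < l.length, δ.edge (l.length + i) = i

/-- Compute the maximum length of a trail in register `5`. -/
def lengthProg : Program := block
  [block [.const 4 1, .copy 18 2, .add 19 3 3, .add 19 19 4],
    .whileLt 18 19 (block [.add 18 18 2, .add 5 5 4])]

theorem ends_lengthProg {s : State} {p q : ℕ} (h2 : s.reg 2 = p) (h3 : s.reg 3 = q)
    (h5 : s.reg 5 = 0) (hp : 0 < p) :
    Ends lengthProg s (2 * q / p * 4 + 7) fun s' => s'.reg 4 = 1 ∧ s'.reg 5 = 2 * q / p := by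
  refine ends_block_cons (T := 5) (Q' := fun s' => s'.reg 4 = 1 ∧ s'.reg 18 = p ∧
    s'.reg 19 = 2 * q + 1) (ends_flat rfl le_rfl ?_) ?_ (T' := 2 * q / p * 4 + 2) (by omega)
  · simp only [eval_block_cons, eval_block_nil, Program.eval, State.setReg_reg]
    norm_num
    omega
  rintro s₁ ha₁ ⟨h4, h18, h19⟩
  have h2₁ : s₁.reg 2 = p := (ha₁.1 2 (by decide)).trans h2
  have h5₁ : s₁.reg 5 = 0 := (ha₁.1 5 (by decide)).trans h5
  -- Register `18` is one multiple of `p` ahead of the quotient in register `5`, so the loop stops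
  -- at the first multiple of `p` exceeding `2q`.
  refine ends_block_cons (ends_whileLt (T := 3) (fun s' => s'.reg 18 = p * (s'.reg 5 + 1) ∧
    p * s'.reg 5 ≤ 2 * q) (fun s' => 2 * q / p - s'.reg 5) ?_ (by simp [h18, h5₁])) ?_ (T' := 1)
    (by simp [h5₁])
  · rintro s' ha ⟨e18, e5⟩ hlt
    have e2 : s'.reg 2 = p := (ha.1 2 (by decide)).trans h2₁
    have e4 : s'.reg 4 = 1 := (ha.1 4 (by decide)).trans h4
    have e19 : s'.reg 19 = 2 * q + 1 := (ha.1 19 (by decide)).trans h19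
    have hle : s'.reg 5 + 1 ≤ 2 * q / p := by
      rw [Nat.le_div_iff_mul_le hp, mul_comm]
      omega
    refine ends_flat rfl le_rfl ?_
    simp only [eval_block_cons, eval_block_nil, Program.eval, State.setReg_reg, e2, e4]
    norm_num
    rw [e18]
    refine ⟨⟨by ring, ?_⟩, by omega⟩
    rw [← e18]
    omega
  · rintro s' ha ⟨⟨e18, e5⟩, hlt⟩
    have e4 : s'.reg 4 = 1 := (ha.1 4 (by decide)).trans h4
    have e19 : s'.reg 19 = 2 * q + 1 := (ha.1 19 (by decide)).trans h19
    refine ends_block_nil le_rfl ⟨e4, ?_⟩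
    refine (Nat.div_eq_of_lt_le ?_ ?_).symm
    · rwa [mul_comm _ p]
    · rw [mul_comm _ p]
      omega

/-- Store the darts in arrays `3`, `4` and `5`. -/
def dartsProg : Program := forLt 11 1 (block [.load 23 0 11, .load 24 1 11, .store 3 11 23,
  .store 4 11 24, .store 5 11 11, .add 25 1 11, .store 3 25 24, .store 4 25 23, .store 5 25 11])

theorem ends_dartsProg {s : State} {m : ℕ} (h1 : s.reg 1 = m) (h4 : s.reg 4 = 1) :
    Ends dartsProg s (m * 12 + 2) fun s' => ∀ i < m,
      (s'.arr 3 i = s.arr 0 i ∧ s'.arr 4 i = s.arr 1 i ∧ s'.arr 5 i = i) ∧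
      (s'.arr 3 (m + i) = s.arr 1 i ∧ s'.arr 4 (m + i) = s.arr 0 i ∧ s'.arr 5 (m + i) = i) := by
  refine (ends_forLt (T := 10) (N := m) (fun k s' => ∀ i < k,
      (s'.arr 3 i = s.arr 0 i ∧ s'.arr 4 i = s.arr 1 i ∧ s'.arr 5 i = i) ∧
      (s'.arr 3 (m + i) = s.arr 1 i ∧ s'.arr 4 (m + i) = s.arr 0 i ∧ s'.arr 5 (m + i) = i))
    h1 h4 (by decide) (by simp) ?_).mono le_rfl fun _ _ h => h
  intro k s' hk h11 ha hI
  have e0 : s'.arr 0 = s.arr 0 := ha.2 0 (by decide)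
  have e1 : s'.arr 1 = s.arr 1 := ha.2 1 (by decide)
  have er : s'.reg 1 = m := (ha.1 1 (by decide)).trans h1
  refine ends_flat rfl le_rfl ?_
  simp only [eval_block_cons, eval_block_nil, Program.eval, State.setReg_arr, State.setReg_reg,
    State.setArr_reg, State.setArr_arr, h11, e0, e1, er]
  norm_num [Function.update_apply, h11, e0, e1, er]
  intro i hi
  rcases eq_or_ne i k with rfl | hne
  · simp only [if_pos]
    rw [if_neg (by omega), if_neg (by omega), if_neg (by omega)]
    simp
  · obtain ⟨⟨a1, a2, a3⟩, a4, a5, a6⟩ := hI i (by omega)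
    have : i ≠ m + k := by omega
    have : m + i ≠ k := by omega
    simp [*]

/-- Compute the power of register `8` to register `5` in register `7`. -/
def powProg : Program := block [.const 7 1,
  forLt 11 5 (block [.const 18 0, forLt 12 8 (.add 18 18 7), .copy 7 18])]

theorem ends_powProg {s : State} {L B : ℕ} (h4 : s.reg 4 = 1) (h5 : s.reg 5 = L)
    (h8 : s.reg 8 = B) : Ends powProg s (L * (B * 3 + 7) + 4) fun s' => s'.reg 7 = B ^ L := by
  refine ends_block_cons (T := 1) (ends_flat (Q := fun s' => s' = s.setReg 7 1) rfl le_rfl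
    rfl) ?_ (T' := L * (B * 3 + 7) + 3) (by omega)
  rintro _ - rfl
  refine ends_block_cons (ends_forLt (T := B * 3 + 5) (N := L) (fun k s' => s'.reg 7 = B ^ k)
    (by simp [State.setReg_reg, h5]) (by simp [State.setReg_reg, h4]) (by decide)
    (by simp [State.setReg_reg]) ?_) (fun s' _ h => ends_block_nil le_rfl h)
    (by rw [add_assoc (B * 3)])
  rintro k s₁ hk - ha₁ h7
  have e4 : s₁.reg 4 = 1 := (ha₁.1 4 (by decide)).trans (by simp [State.setReg_reg, h4])
  have e8 : s₁.reg 8 = B := (ha₁.1 8 (by decide)).trans (by simp [State.setReg_reg, h8])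
  refine ends_block_cons (T := 1) (ends_flat (Q := fun s' => s' = s₁.setReg 18 0) rfl le_rfl
    rfl) ?_ (T' := B * 3 + 4) (by omega)
  rintro _ - rfl
  refine ends_block_cons (ends_forLt (T := 1) (N := B) (fun j s' => s'.reg 18 = j * B ^ k)
    (by simp [State.setReg_reg, e8]) (by simp [State.setReg_reg, e4]) (by decide)
    (by simp [State.setReg_reg]) ?_) ?_ (T' := 2) (by omega)
  · rintro j s₂ hj - ha₂ h18
    have e7 : s₂.reg 7 = B ^ k := (ha₂.1 7 (by decide)).trans (by simp [State.setReg_reg, h7])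
    refine ends_flat rfl le_rfl ?_
    simp only [Program.eval, State.setReg_reg, h18, e7]
    norm_num
    ring
  · intro s₂ ha₂ h18
    refine ends_flat rfl le_rfl ?_
    simp only [eval_block_cons, eval_block_nil, Program.eval, State.setReg_reg, h18]
    norm_num
    ring

/-- Prepare the memory for the local search. -/
def initProg : Program := block
  [lengthProg, dartsProg, block [.add 6 1 1, .add 8 6 4, .add 9 0 4], powProg]

theorem ends_initProg {l : List (Fin n × Fin n)} {p q : ℕ} (hp : 0 < p) :
    Ends initProg (inputState l p q) (2 * q / p * (l.length * 6 + 14) + l.length * 12 + 18)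
      fun s => ∃ δ : Darts, δ.Represents l ∧
        δ.Loaded (2 * q / p) ((δ.size + 1) ^ (2 * q / p)) s ∧ ∀ i, s.arr 2 i = 0 := by
  set L := 2 * q / p with hL
  set m := l.length with hm
  refine ends_block_cons (ends_lengthProg (p := p) (q := q) (by simp [inputState])
    (by simp [inputState]) (by simp [inputState]) hp) ?_
    (T' := L * (m * 6 + 10) + m * 12 + 11) (by rw [← hL]; ring_nf; omega)
  rintro s₁ ha₁ ⟨h4₁, h5₁⟩
  have h1₁ : s₁.reg 1 = m := (ha₁.1 1 (by decide)).trans (by simp [inputState, hm])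
  refine ends_block_cons (ends_dartsProg h1₁ h4₁) ?_ (T' := L * (m * 6 + 10) + 9) (by omega)
  intro s₂ ha₂ hd
  have h0₂ : s₂.reg 0 = n := (ha₂.1 0 (by decide)).trans ((ha₁.1 0 (by decide)).trans
    (by simp [inputState]))
  have h1₂ : s₂.reg 1 = m := (ha₂.1 1 (by decide)).trans h1₁
  have h4₂ : s₂.reg 4 = 1 := (ha₂.1 4 (by decide)).trans h4₁
  have h5₂ : s₂.reg 5 = L := (ha₂.1 5 (by decide)).trans h5₁
  refine ends_block_cons (T := 4) (Q' := fun s' => s'.reg 6 = m + m ∧ s'.reg 8 = m + m + 1 ∧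
    s'.reg 9 = n + 1) (ends_flat rfl le_rfl ?_) ?_ (T' := L * (m * 6 + 10) + 5) (by omega)
  · simp [eval_block_cons, eval_block_nil, Program.eval, State.setReg_reg, h0₂, h1₂, h4₂]
  rintro s₃ ha₃ ⟨h6₃, h8₃, h9₃⟩
  have h4₃ : s₃.reg 4 = 1 := (ha₃.1 4 (by decide)).trans h4₂
  have h5₃ : s₃.reg 5 = L := (ha₃.1 5 (by decide)).trans h5₂
  refine ends_block_cons (ends_powProg h4₃ h5₃ h8₃) ?_ (T' := 1) (by ring_nf; omega)
  intro s₄ ha₄ h7₄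
  refine ends_block_nil le_rfl ⟨⟨n, m, m + m, s₄.arr 3, s₄.arr 4, s₄.arr 5⟩, ?_, ?_, ?_⟩
  · have e : ∀ k, s₄.arr k = s₂.arr k := fun k =>
      (ha₄.2 k (by simp [powProg, forLt, block, Program.arrs])).trans
        (ha₃.2 k (by simp [block, Program.arrs]))
    have e0 : ∀ i (h : i < l.length), s₁.arr 0 i = l[i].1 := fun i h => by
      rw [ha₁.2 0 (by decide)]
      simp [inputState, h]
    have e1 : ∀ i (h : i < l.length), s₁.arr 1 i = l[i].2 := fun i h => by
      rw [ha₁.2 1 (by decide)]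
      simp [inputState, h]
    refine ⟨rfl, rfl, rfl, fun i h => ?_, fun i h => ?_, fun i h => ?_, fun i h => ?_,
      fun i h => ?_, fun i h => ?_⟩ <;> simp only [e]
    · rw [(hd i h).1.1, e0 i h]
    · rw [(hd i h).1.2.1, e1 i h]
    · rw [(hd i h).1.2.2]
    · rw [(hd i h).2.1, e1 i h]
    · rw [(hd i h).2.2.1, e0 i h]
    · rw [(hd i h).2.2.2]
  · have e : ∀ r, r ∉ powProg.regs → s₄.reg r = s₃.reg r := ha₄.1
    have e' : ∀ r, r ∉ powProg.regs → r ∉ [6, 8, 9] → s₄.reg r = s₂.reg r := fun r h h' =>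
      (e r h).trans (ha₃.1 r h')
    refine ⟨?_, ?_, ?_, ?_, ?_, h7₄, ?_, ?_, ?_, rfl, rfl, rfl⟩
    · rw [e' 0 (by decide) (by decide), h0₂]
    · rw [e' 1 (by decide) (by decide), h1₂]
    · rw [e' 4 (by decide) (by decide), h4₂]
    · rw [e' 5 (by decide) (by decide), h5₂]
    · rw [e 6 (by decide), h6₃]
    · rw [e 8 (by decide), h8₃]
    · rw [e 9 (by decide), h9₃]
    · rw [e' 10 (by decide) (by decide), ha₂.1 10 (by decide), ha₁.1 10 (by decide)]
      simp [inputState]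
  · intro i
    rw [ha₄.2 2 (by decide), ha₃.2 2 (by decide), ha₂.2 2 (by decide), ha₁.2 2 (by decide)]
    simp [inputState]

end Init

/-! ### Translation between stored darts and walks in the graph -/

section Numbering

variable {n : ℕ} {G : SimpleGraph (Fin n)} {l : List (Fin n × Fin n)} {δ : Darts} {F : ℕ → ℕ}

/-- The listed edges with a nonzero value. -/
def edgesOf (l : List (Fin n × Fin n)) (F : ℕ → ℕ) : Finset (Sym2 (Fin n)) :=
  (Finset.univ.filter (fun i : Fin l.length => F i ≠ 0)).image
    (fun i => s((l[i]).1, (l[i]).2))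

theorem outputEdges_eq (l : List (Fin n × Fin n)) (s : State) :
    outputEdges l s = edgesOf l (s.arr 2) := rfl

theorem IsEdgeList.injective (hl : IsEdgeList G l) {i j : ℕ} (hi : i < l.length)
    (hj : j < l.length) (h : s((l[i]).1, (l[i]).2) = s((l[j]).1, (l[j]).2)) : i = j := by
  refine (List.Nodup.getElem_inj_iff hl.1 (hi := by simpa) (hj := by simpa)).1 ?_
  simpa using h

theorem IsEdgeList.adj (hl : IsEdgeList G l) {i : ℕ} (hi : i < l.length) :
    G.Adj (l[i]).1 (l[i]).2 := by
  rw [← SimpleGraph.mem_edgeSet, ← hl.2]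
  exact List.mem_map.2 ⟨l[i], List.getElem_mem hi, rfl⟩

theorem IsEdgeList.exists_index (hl : IsEdgeList G l) {e : Sym2 (Fin n)} (he : e ∈ G.edgeSet) :
    ∃ (i : ℕ) (hi : i < l.length), s((l[i]).1, (l[i]).2) = e := by
  obtain ⟨x, hx, rfl⟩ := List.mem_map.1 ((hl.2 e).2 he)
  obtain ⟨i, hi, rfl⟩ := List.mem_iff_getElem.1 hx
  exact ⟨i, hi, rfl⟩

theorem mem_edgesOf (hl : IsEdgeList G l) {i : ℕ} (hi : i < l.length) :
    s((l[i]).1, (l[i]).2) ∈ edgesOf l F ↔ F i ≠ 0 := by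
  simp only [edgesOf, Finset.mem_image, Finset.mem_filter, Finset.mem_univ, true_and]
  constructor
  · rintro ⟨j, hj, h⟩
    have : (j : ℕ) = i := hl.injective j.2 hi h
    rwa [← this]
  · exact fun h => ⟨⟨i, hi⟩, h, rfl⟩

theorem edgesOf_subset (hl : IsEdgeList G l) {e : Sym2 (Fin n)} (he : e ∈ edgesOf l F) :
    e ∈ G.edgeSet := by
  simp only [edgesOf, Finset.mem_image, Finset.mem_filter, Finset.mem_univ, true_and] at he
  obtain ⟨j, -, rfl⟩ := he
  exact hl.adj j.2

theorem card_edgesOf (hl : IsEdgeList G l) (hF : ∀ i < l.length, F i ≤ 1) :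
    (edgesOf l F).card = ∑ i ∈ Finset.range l.length, F i := by
  have hinj : Function.Injective fun i : Fin l.length => s((l[i]).1, (l[i]).2) :=
    fun i j h => Fin.ext (hl.injective i.2 j.2 h)
  rw [edgesOf, Finset.card_image_of_injective _ hinj, Finset.card_filter, Finset.sum_range]
  refine Finset.sum_congr rfl fun i _ => ?_
  have := hF i i.2
  split_ifs <;> omega

theorem edgesOf_congr {F' : ℕ → ℕ} (h : ∀ i < l.length, F i = F' i) :
    edgesOf l F = edgesOf l F' := by
  rw [edgesOf, edgesOf]
  congr 1
  ext i
  simp [h i i.2]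

/-- The darts of the graph are numbered by `idx`. -/
structure Darts.Numbering (δ : Darts) (l : List (Fin n × Fin n)) (G : SimpleGraph (Fin n))
    (idx : G.Dart → ℕ) : Prop where
  tail : ∀ a, δ.tail (idx a) = a.fst
  head : ∀ a, δ.head (idx a) = a.snd
  edge : ∀ a b, δ.edge (idx a) = δ.edge (idx b) ↔ a.edge = b.edge
  mem : ∀ F a, a.edge ∈ edgesOf l F ↔ F (δ.edge (idx a)) ≠ 0
  lt : ∀ a, idx a < δ.size
  surj : ∀ d < δ.size, ∃ a, idx a = d
  edge_lt : ∀ a, δ.edge (idx a) < δ.m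

theorem Darts.Represents.cases (h : δ.Represents l) {d : ℕ} (hd : d < δ.size) :
    ∃ (i : ℕ) (hi : i < l.length), δ.edge d = i ∧
      ((d = i ∧ δ.tail d = (l[i]).1 ∧ δ.head d = (l[i]).2) ∨
        (d = l.length + i ∧ δ.tail d = (l[i]).2 ∧ δ.head d = (l[i]).1)) := by
  rw [h.size] at hd
  rcases lt_or_ge d l.length with hlt | hge
  · exact ⟨d, hlt, h.edge d hlt, .inl ⟨rfl, h.tail d hlt, h.head d hlt⟩⟩
  · obtain ⟨i, rfl⟩ := Nat.exists_eq_add_of_le hge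
    have hi : i < l.length := by omega
    exact ⟨i, hi, h.edge' i hi, .inr ⟨rfl, h.tail' i hi, h.head' i hi⟩⟩

theorem Darts.Represents.wf (h : δ.Represents l) : δ.WF := by
  constructor <;> intro d hd <;> obtain ⟨i, hi, h1, ⟨-, h2, h3⟩ | ⟨-, h2, h3⟩⟩ := h.cases hd
  · rw [h2, h.n]; exact Fin.is_lt _
  · rw [h2, h.n]; exact Fin.is_lt _
  · rw [h1, h.m]; exact hi
  · rw [h1, h.m]; exact hi

theorem Darts.Represents.eq_of_tail_eq (h : δ.Represents l) (hl : IsEdgeList G l) {d d' : ℕ}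
    (hd : d < δ.size) (hd' : d' < δ.size) (ht : δ.tail d = δ.tail d')
    (he : δ.edge d = δ.edge d') : d = d' := by
  obtain ⟨i, hi, h1, h2⟩ := h.cases hd
  obtain ⟨j, hj, h3, h4⟩ := h.cases hd'
  obtain rfl : i = j := by rw [← h1, ← h3, he]
  have hne : ((l[i]).1 : ℕ) ≠ (l[i]).2 := fun hh => (hl.adj hi).ne (Fin.ext hh)
  rcases h2 with ⟨h2, h2', -⟩ | ⟨h2, h2', -⟩ <;> rcases h4 with ⟨h4, h4', -⟩ | ⟨h4, h4', -⟩ <;>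
    omega

theorem Darts.Represents.exists_numbering (h : δ.Represents l) (hl : IsEdgeList G l) :
    ∃ idx, δ.Numbering l G idx := by
  have key : ∀ a : G.Dart, ∃ d, d < δ.size ∧ δ.tail d = a.fst ∧ δ.head d = a.snd ∧
      ∃ hi : δ.edge d < l.length, s((l[δ.edge d]).1, (l[δ.edge d]).2) = a.edge := by
    intro a
    obtain ⟨i, hi, he⟩ := hl.exists_index a.edge_mem
    have he' : s((l[i]).1, (l[i]).2) = s(a.fst, a.snd) := he
    rw [Sym2.eq_iff] at he'
    rcases he' with ⟨h1, h2⟩ | ⟨h1, h2⟩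
    · have hed := h.edge i hi
      exact ⟨i, by rw [h.size]; omega, by rw [h.tail i hi, h1], by rw [h.head i hi, h2],
        by rwa [hed], by simpa only [hed] using he⟩
    · have hed := h.edge' i hi
      exact ⟨l.length + i, by rw [h.size]; omega, by rw [h.tail' i hi, h2],
        by rw [h.head' i hi, h1], by rwa [hed], by simpa only [hed] using he⟩
  choose idx h1 h2 h3 h4 h5 using key
  refine ⟨idx, h2, h3, fun a b => ?_, fun F a => ?_, h1, fun d hd => ?_, fun a => h.m ▸ h4 a⟩
  · rw [← h5 a, ← h5 b]
    exact ⟨fun hh => by simp only [hh], hl.injective _ _⟩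
  · rw [← h5 a, mem_edgesOf hl]
  · obtain ⟨i, hi, e1, e2⟩ := h.cases hd
    have hadj := hl.adj hi
    rcases e2 with ⟨e2, e3, e4⟩ | ⟨e2, e3, e4⟩
    · refine ⟨⟨((l[i]).1, (l[i]).2), hadj⟩, h.eq_of_tail_eq hl (h1 _) hd ?_ ?_⟩
      · rw [h2, e3]
      · rw [e1]
        exact hl.injective (h4 _) hi (h5 _)
    · refine ⟨⟨((l[i]).2, (l[i]).1), hadj.symm⟩, h.eq_of_tail_eq hl (h1 _) hd ?_ ?_⟩
      · rw [h2, e3]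
      · rw [e1]
        exact hl.injective (h4 _) hi ((h5 _).trans Sym2.eq_swap)

variable {idx : G.Dart → ℕ}

theorem Darts.Numbering.injective (h : δ.Numbering l G idx) : Function.Injective idx := by
  intro a b hab
  refine SimpleGraph.Dart.ext _ _ (Prod.ext (Fin.ext ?_) (Fin.ext ?_))
  · exact (h.tail a).symm.trans (hab ▸ h.tail b)
  · exact (h.head a).symm.trans (hab ▸ h.head b)

theorem Darts.Numbering.noBad_iff (h : δ.Numbering l G idx) (hl : IsEdgeList G l) :
    δ.NoBad F ↔ IsTwoMatching G (edgesOf l F) := by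
  have hrel : ∀ {x y}, Rel (edgesOf l F) x y → ∃ a : G.Dart, a.fst = x ∧ a.snd = y ∧
      F (δ.edge (idx a)) ≠ 0 := by
    intro x y hxy
    have hadj : G.Adj x y := edgesOf_subset hl hxy
    exact ⟨⟨(x, y), hadj⟩, rfl, rfl, (h.mem F ⟨(x, y), hadj⟩).1 hxy⟩
  have hrel' : ∀ a : G.Dart, F (δ.edge (idx a)) ≠ 0 → Rel (edgesOf l F) a.fst a.snd :=
    fun a ha => (h.mem F a).2 ha
  rw [isTwoMatching_iff]
  constructor
  · intro hb
    refine ⟨fun e he => edgesOf_subset hl he, Rel.symm, fun x hx => ?_, ?_, ?_⟩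
    · exact (G.irrefl (edgesOf_subset hl hx : G.Adj x x)).elim
    · have wlog_lt : ∀ {a b c : G.Dart}, a.fst = b.fst → b.fst = c.fst →
          F (δ.edge (idx a)) ≠ 0 → F (δ.edge (idx b)) ≠ 0 → F (δ.edge (idx c)) ≠ 0 →
          ¬ (idx a < idx b ∧ idx b < idx c) := by
        intro a b c hab hbc ha hb' hc hlt
        refine hb _ (h.lt a) _ (h.lt b) _ (h.lt c) ⟨ha, hb', hc, .inr ⟨?_, ?_, hlt⟩⟩
        · rw [h.tail, h.tail, hab]
        · rw [h.tail, h.tail, hbc]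
      intro v x y z hx hy hz
      obtain ⟨a, ha, rfl, ha'⟩ := hrel hx
      obtain ⟨b, hb, rfl, hb'⟩ := hrel hy
      obtain ⟨c, hc, rfl, hc'⟩ := hrel hz
      by_contra! hne
      have h1 : idx a ≠ idx b := fun hh => hne.1 (by rw [h.injective hh])
      have h2 : idx b ≠ idx c := fun hh => hne.2.1 (by rw [h.injective hh])
      have h3 : idx a ≠ idx c := fun hh => hne.2.2 (by rw [h.injective hh])
      have eab := ha.trans hb.symm
      have ebc := hb.trans hc.symm
      have eac := ha.trans hc.symm
      -- Stars are tested only for increasing dart numbers, so all six orders of the three darts are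
      -- excluded.
      have k1 := wlog_lt eab ebc ha' hb' hc'
      have k2 := wlog_lt eac ebc.symm ha' hc' hb'
      have k3 := wlog_lt eab.symm eac hb' ha' hc'
      have k4 := wlog_lt ebc eac.symm hb' hc' ha'
      have k5 := wlog_lt eac.symm eab hc' ha' hb'
      have k6 := wlog_lt ebc.symm eab.symm hc' hb' ha'
      omega
    · intro x y z hxy hyz hxz
      obtain ⟨a, rfl, rfl, ha'⟩ := hrel hxy
      obtain ⟨b, hb1, rfl, hb'⟩ := hrel hyz
      obtain ⟨c, hc1, hc2, hc'⟩ := hrel hxz.symm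
      refine hb _ (h.lt a) _ (h.lt b) _ (h.lt c) ⟨ha', hb', hc', .inl ⟨?_, ?_, ?_⟩⟩
      · rw [h.head, h.tail, hb1]
      · rw [h.head, h.tail, hc1]
      · rw [h.head, h.tail, hc2]
  · rintro ⟨-, ht⟩ d₁ h₁ d₂ h₂ d₃ h₃ ⟨f1, f2, f3, hh⟩
    obtain ⟨a, rfl⟩ := h.surj _ h₁
    obtain ⟨b, rfl⟩ := h.surj _ h₂
    obtain ⟨c, rfl⟩ := h.surj _ h₃
    have r1 := hrel' a f1
    have r2 := hrel' b f2
    have r3 := hrel' c f3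
    simp only [h.tail, h.head, ← Fin.ext_iff] at hh
    rcases hh with ⟨k1, k2, k3⟩ | ⟨k1, k2, k3, k4⟩
    · rw [k1] at r1
      rw [k2] at r2
      rw [k3] at r3
      exact ht.tri r1 r2 r3.symm
    · rw [k1] at r1
      rw [← k2] at r3
      have inj : ∀ {a b : G.Dart}, a.fst = b.fst → a.snd = b.snd → ¬ idx a < idx b := by
        intro a b e1 e2
        rw [SimpleGraph.Dart.ext _ _ (Prod.ext e1 e2)]
        exact lt_irrefl _
      rcases ht.deg r1 r2 r3 with e | e | e
      · exact inj k1 e k3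
      · exact inj k2 e k4
      · exact inj (k1.trans k2) e (k3.trans k4)

theorem Darts.Numbering.mem_map_edge (h : δ.Numbering l G idx) {as : List G.Dart} {a : G.Dart} :
    δ.edge (idx a) ∈ (as.map idx).map δ.edge ↔ a.edge ∈ as.map SimpleGraph.Dart.edge := by
  simp only [List.mem_map, List.map_map, Function.comp_apply, h.edge]

theorem Darts.Numbering.edgesOf_flipped (h : δ.Numbering l G idx) (hl : IsEdgeList G l)
    (hF : ∀ e < δ.m, F e ≤ 1) (as : List G.Dart) :
    edgesOf l (δ.flipped F (as.map idx)) =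
      edgesOf l F ∆ (as.map SimpleGraph.Dart.edge).toFinset := by
  ext e
  rw [Finset.mem_symmDiff, List.mem_toFinset]
  by_cases he : e ∈ G.edgeSet
  · obtain ⟨a, rfl⟩ : ∃ a : G.Dart, a.edge = e := by
      induction e with
      | _ x y => exact ⟨⟨(x, y), he⟩, rfl⟩
    have := hF _ (h.edge_lt a)
    rw [h.mem, h.mem, Darts.flipped]
    by_cases hm : a.edge ∈ as.map SimpleGraph.Dart.edge
    · rw [if_pos (h.mem_map_edge.2 hm)]
      simp only [hm, not_true_eq_false, and_false, false_or, true_and]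
      omega
    · rw [if_neg (mt h.mem_map_edge.1 hm)]
      simp only [hm, not_false_eq_true, and_true, false_and, or_false]
  · have h1 : ∀ F, e ∉ edgesOf l F := fun F hF => he (edgesOf_subset hl hF)
    have h2 : e ∉ as.map SimpleGraph.Dart.edge := by
      intro hm
      obtain ⟨a, -, rfl⟩ := List.mem_map.1 hm
      exact he a.edge_mem
    simp [h1, h2]

theorem Darts.Numbering.valid_iff (h : δ.Numbering l G idx) (hF : ∀ e < δ.m, F e ≤ 1)
    {as : List G.Dart} (has : as.IsChain G.DartAdj) :
    δ.Valid F (as.map idx) ↔ (as.map SimpleGraph.Dart.edge).Nodup ∧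
      (as.map SimpleGraph.Dart.edge).IsChain (fun e f => (e ∈ edgesOf l F ∧ f ∉ edgesOf l F) ∨
        (e ∉ edgesOf l F ∧ f ∈ edgesOf l F)) := by
  induction as with
  | nil => simp [Darts.Valid]
  | cons a as ih =>
    rw [List.map_cons, Darts.Valid, ih has.tail, h.mem_map_edge, List.map_cons, List.nodup_cons]
    rcases as with _ | ⟨b, as⟩
    · simp
    · have hab : a.snd = b.fst := (List.isChain_cons_cons.1 has).1
      have f1 := hF _ (h.edge_lt a)
      have f2 := hF _ (h.edge_lt b)
      have hc : F (δ.edge (idx a)) ≠ F (δ.edge (idx b)) ↔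
          (a.edge ∈ edgesOf l F ∧ b.edge ∉ edgesOf l F) ∨
          (a.edge ∉ edgesOf l F ∧ b.edge ∈ edgesOf l F) := by
        rw [h.mem, h.mem]
        omega
      simp only [List.map_cons, List.head?_cons, Option.mem_def, Option.some.injEq, forall_eq',
        h.tail, h.head, hab, hc, true_and, List.isChain_cons_cons]
      tauto

theorem Darts.Numbering.exists_walk (h : δ.Numbering l G idx) :
    ∀ {a : G.Dart} {as : List G.Dart}, δ.Valid F ((a :: as).map idx) →
      ∃ (v : Fin n) (w : G.Walk a.fst v), w.darts = a :: as
  | a, [], _ => ⟨a.snd, .cons a.adj .nil, rfl⟩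
  | a, b :: as, hv => by
    obtain ⟨v, w, hw⟩ := Darts.Numbering.exists_walk h hv.2
    have hab : a.snd = b.fst := by
      have := (hv.1.2 (idx b) rfl).1
      rw [h.head, h.tail] at this
      exact Fin.ext this
    refine ⟨v, .cons (hab ▸ a.adj) w, ?_⟩
    rw [SimpleGraph.Walk.darts_cons, hw]
    congr 1
    exact SimpleGraph.Dart.ext _ _ (Prod.ext rfl hab.symm)

/-- A walk is determined by its darts, and a nonempty valid dart list is the list of darts of a
walk. The validity, size and `NoBad` conditions then match the clauses of `IsAugmentingTrail`. -/
theorem Darts.Represents.flip_iff (h : δ.Represents l) (hl : IsEdgeList G l)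
    (hF : ∀ e < δ.m, F e ≤ 1) {L : ℝ} {K : ℕ} (hL : ∀ k : ℕ, (k : ℝ) ≤ L ↔ k ≤ K)
    {M' : Finset (Sym2 (Fin n))} :
    Flip G L (edgesOf l F) M' ↔ ∃ ds : List ℕ, (∀ d ∈ ds, d < δ.size) ∧ ds.length ≤ K ∧
      δ.Augments F ds ∧ M' = edgesOf l (δ.flipped F ds) := by
  obtain ⟨idx, hi⟩ := h.exists_numbering hl
  have hc : ∀ {F : ℕ → ℕ}, (∀ e < δ.m, F e ≤ 1) →
      (edgesOf l F).card = ∑ e ∈ Finset.range δ.m, F e := fun hF => by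
    rw [card_edgesOf hl (by rwa [← h.m]), h.m]
  have hF' : ∀ ds, ∀ e < δ.m, δ.flipped F ds e ≤ 1 := by
    intro ds e he
    have := hF e he
    rw [Darts.flipped]
    split_ifs <;> omega
  have key : ∀ {u v : Fin n} (w : G.Walk u v), IsAugmentingTrail G (edgesOf l F) w ↔
      δ.Augments F (w.darts.map idx) := by
    intro u v w
    have he : w.edges = w.darts.map SimpleGraph.Dart.edge := rfl
    rw [IsAugmentingTrail, Darts.Augments, hi.valid_iff hF w.isChain_dartAdj_darts,
      hi.noBad_iff hl,
      hi.edgesOf_flipped hl hF, ← hc hF, ← hc (hF' _), hi.edgesOf_flipped hl hF,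
      SimpleGraph.Walk.isTrail_def, ← he]
    tauto
  constructor
  · rintro ⟨u, v, w, hw, hlen, rfl⟩
    refine ⟨w.darts.map idx, ?_, ?_, (key w).1 hw, ?_⟩
    · simp only [List.mem_map]
      rintro _ ⟨a, -, rfl⟩
      exact hi.lt a
    · rw [List.length_map, SimpleGraph.Walk.length_darts]
      exact (hL _).1 hlen
    · rw [hi.edgesOf_flipped hl hF]
      rfl
  · rintro ⟨ds, hds, hlen, hA, rfl⟩
    obtain ⟨as, rfl⟩ : ∃ as : List G.Dart, as.map idx = ds := by
      have : ds ∈ Set.range (List.map idx) := by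
        rw [Set.range_list_map]
        exact fun d hd => hi.surj d (hds d hd)
      exact this
    rcases as with _ | ⟨a, as⟩
    -- The empty list corresponds to no particular walk, but it does not augment since it gains no
    -- edge.
    · have := hA.2.1
      simp [Darts.flipped] at this
    · obtain ⟨v, w, hw⟩ := hi.exists_walk hA.1
      rw [← hw] at hA hlen ⊢
      refine ⟨_, v, w, (key w).2 hA, (hL _).2 ?_, ?_⟩
      · rwa [List.length_map, SimpleGraph.Walk.length_darts] at hlen
      · rw [hi.edgesOf_flipped hl hF]
        rfl

end Numbering

/-! ### The search loop and its running time -/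

section Search

variable {n : ℕ} {G : SimpleGraph (Fin n)} {l : List (Fin n × Fin n)} {δ : Darts}

theorem Darts.length_decode_le {c j : ℕ} : (δ.decode c j).length ≤ j := by
  induction j with
  | zero => simp [Darts.decode]
  | succ j ih =>
    rw [Darts.decode]
    split_ifs
    · simpa using ih
    · omega

/-- The local search: in each pass, all codes are tested. -/
def searchProg : Program := forLt 11 9 (forLt 12 7 checkProg)

/-- A bound on the time for the local search. -/
def searchTime (δ : Darts) (L W : ℕ) : ℕ :=
  (δ.n + 1) * (W * (checkTime δ L W + 2) + 4) + 2

theorem ends_searchProg (h : δ.Represents l) (hl : IsEdgeList G l) {Λ : ℝ} {L : ℕ}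
    (hL : ∀ k : ℕ, (k : ℝ) ≤ Λ ↔ k ≤ L) {s : State}
    (hs : δ.Loaded L ((δ.size + 1) ^ L) s) (h2 : ∀ i, s.arr 2 i = 0) :
    Ends searchProg s (searchTime δ L ((δ.size + 1) ^ L)) fun s' =>
      IsLocalSearchResult G Λ (outputEdges l s') := by
  set W := (δ.size + 1) ^ L with hW
  have hflip : ∀ {F : ℕ → ℕ} (c : ℕ), (∀ e < δ.m, F e ≤ 1) → δ.Augments F (δ.decode c L) →
      Flip G Λ (edgesOf l F) (edgesOf l (δ.flipped F (δ.decode c L))) := fun c hF hA =>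
    (h.flip_iff hl hF hL).2 ⟨_, Darts.decode_lt, Darts.length_decode_le, hA, rfl⟩
  have hflip' : ∀ {F : ℕ → ℕ} {F' : ℕ → ℕ} (c : ℕ), (∀ e < δ.m, F e ≤ 1) →
      (∀ e < δ.m, F' e = δ.flipped F (δ.decode c L) e) →
      (∀ e < δ.m, F' e ≤ 1) ∧ edgesOf l F' = edgesOf l (δ.flipped F (δ.decode c L)) := by
    intro F F' c hF hF'
    refine ⟨fun e he => ?_, edgesOf_congr (by rwa [← h.m])⟩
    have := hF e he
    rw [hF' e he, Darts.flipped]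
    split_ifs <;> omega
  -- After `k` passes there have been at least `k` flips, or the current set is locally optimal.
  refine (ends_forLt (N := δ.n + 1) (T := W * (checkTime δ L W + 2) + 2) (fun k s' =>
    (∀ e < δ.m, s'.arr 2 e ≤ 1) ∧ ∃ j, Run G Λ j (edgesOf l (s'.arr 2)) ∧
      (k ≤ j ∨ ∀ M', ¬ Flip G Λ (edgesOf l (s'.arr 2)) M')) hs.passes hs.one (by decide)
    ?_ ?_).mono le_rfl ?_
  · refine ⟨fun e _ => by simp [State.setReg_arr, h2], 0, ?_, .inl le_rfl⟩
    have : edgesOf l (s.arr 2) = ∅ := by simp [edgesOf, h2]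
    rw [State.setReg_arr, this]
    exact .start
  · rintro k s₁ hk - ha₁ ⟨hF₁, j₀, hj₀, hor⟩
    have hL₁ := hs.agree ha₁ (by decide) (by decide)
    -- Within a pass, either nothing has changed and no code so far augments, or a flip has
    -- occurred. The second case records that the set at the start of the pass had a flip, which
    -- later rules out that it was locally optimal.
    refine (ends_forLt (N := W) (T := checkTime δ L W) (fun c s' =>
      (∀ e < δ.m, s'.arr 2 e ≤ 1) ∧
      ((s'.arr 2 = s₁.arr 2 ∧ ∀ c' < c, ¬ δ.Augments (s₁.arr 2) (δ.decode c' L)) ∨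
        ((∃ M', Flip G Λ (edgesOf l (s₁.arr 2)) M') ∧
          ∃ j, j₀ + 1 ≤ j ∧ Run G Λ j (edgesOf l (s'.arr 2))))) hL₁.W hL₁.one (by decide)
      ⟨hF₁, .inl ⟨rfl, by simp⟩⟩ ?_).mono (by omega) ?_
    · rintro c s₂ hc h12 ha₂ ⟨hF₂, hI⟩
      have hL₂ := hL₁.agree ha₂ (by decide) (by decide)
      refine (ends_checkProg h.wf hL₂ rfl hF₂ hc h12).mono le_rfl ?_
      rintro s₃ - (⟨hA, e⟩ | ⟨hA, e⟩) <;> rw [State.setReg_arr]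
      · rw [e]
        refine ⟨hF₂, hI.imp_left fun hI => ⟨hI.1, fun c' hc' => ?_⟩⟩
        rcases Nat.lt_succ_iff_lt_or_eq.1 hc' with hc' | rfl
        · exact hI.2 c' hc'
        · rwa [← hI.1]
      · obtain ⟨hF₃, e₃⟩ := hflip' c hF₂ e
        refine ⟨hF₃, .inr ?_⟩
        have hf := hflip c hF₂ hA
        rw [e₃]
        rcases hI with ⟨e₂, -⟩ | ⟨hex, j, hj, hr⟩
        · rw [e₂] at hf ⊢
          exact ⟨⟨_, hf⟩, _, le_rfl, hj₀.flip hf⟩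
        · exact ⟨hex, _, by omega, hr.flip hf⟩
    · rintro s₂ - ⟨hF₂, hI⟩
      refine ⟨hF₂, ?_⟩
      rw [State.setReg_arr]
      rcases hI with ⟨e, hno⟩ | ⟨⟨M', hM'⟩, j, hj, hr⟩
      · rw [e]
        refine ⟨j₀, hj₀, .inr fun M' hM' => ?_⟩
        obtain ⟨ds, hds, hlen, hA, -⟩ := (h.flip_iff hl hF₁ hL).1 hM'
        obtain ⟨c, hc, rfl⟩ := Darts.exists_decode hds hlen
        exact hno c hc hA
      · exact ⟨j, hr, .inl (hor.elim (fun hle => by omega) fun hno => (hno _ hM').elim)⟩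
  · rintro s' - ⟨-, j, hj, hor⟩
    rw [outputEdges_eq]
    -- More than `n` flips are impossible, so the other alternative holds after `n + 1` passes.
    refine ⟨⟨j, hj⟩, hor.resolve_left fun hle => ?_⟩
    have := hj.le_card
    rw [Fintype.card_fin] at this
    have := h.n
    omega

theorem IsEdgeList.two_mul_length_lt (hl : IsEdgeList G l) :
    l.length + l.length + 1 ≤ max n 2 ^ 2 := by
  classical
  have h1 : l.length ≤ n.choose 2 := by
    calc l.length = (l.map (fun x => s(x.1, x.2))).toFinset.card := by
          rw [List.toFinset_card_of_nodup hl.1, List.length_map]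
      _ ≤ G.edgeFinset.card := by
          refine Finset.card_le_card fun e he => ?_
          rw [SimpleGraph.mem_edgeFinset, ← hl.2]
          exact List.mem_toFinset.1 he
      _ ≤ _ := by simpa using G.card_edgeFinset_le_card_choose_two
  have h2 : n.choose 2 * 2 = n * (n - 1) := by
    rw [Nat.choose_two_right, Nat.div_mul_cancel (Nat.even_mul_pred_self n).two_dvd]
  rcases n with _ | n
  · simp at h1
    simp [h1]
  · rw [Nat.add_sub_cancel] at h2
    have : (n + 1) ^ 2 ≤ max (n + 1) 2 ^ 2 := Nat.pow_le_pow_left (le_max_left _ _) 2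
    nlinarith

theorem checkTime_le {E A L W : ℕ} (hE : 1 ≤ E) (hA : 1 ≤ A) (hm : δ.m ≤ E) (hs : δ.size ≤ E)
    (hL : L ≤ A) (hW : W ≤ A ^ 2) : checkTime δ L W + 2 ≤ 203 * (A ^ 3 * E ^ 3) := by
  have h1 : L * (4 * W + 70) ≤ 74 * A ^ 3 := by
    calc L * (4 * W + 70) ≤ A * (4 * A ^ 2 + 70 * A ^ 2) := by
          gcongr
          exact Nat.le_mul_of_pos_right _ (by positivity)
      _ = _ := by ring
  have h2 : δ.size * (δ.size * (δ.size * 52 + 4) + 4) ≤ 60 * E ^ 3 := by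
    calc _ ≤ E * (E * (E * 52 + 4) + 4) := by gcongr
      _ = 52 * E ^ 3 + 4 * E ^ 2 + 4 * E ^ 1 := by ring
      _ ≤ 52 * E ^ 3 + 4 * E ^ 3 + 4 * E ^ 3 := by gcongr <;> omega
      _ = _ := by ring
  have h3 : E ≤ E ^ 3 := Nat.le_self_pow (by omega) E
  have h4 : A ^ 3 ≤ A ^ 3 * E ^ 3 := Nat.le_mul_of_pos_right _ (by positivity)
  have h5 : E ^ 3 ≤ A ^ 3 * E ^ 3 := Nat.le_mul_of_pos_left _ (by positivity)
  unfold checkTime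
  omega

/-- With `A = N ^ L` and `E = N ^ 2` there are at most `A ^ 2` codes, a check costs `O(A ^ 3 * E ^
3)`, and there are at most `2 * N` passes. The constants sum to less than `2 ^ 10 ≤ N ^ 10`, and `10
+ 1 + 5 * L + 6 = 5 * L + 17`. -/
theorem time_le {N L : ℕ} (hN : 2 ≤ N) (hn : δ.n ≤ N) (hm : δ.m ≤ N ^ 2)
    (hs : δ.size + 1 ≤ N ^ 2) : L * (δ.m * 6 + 14) + δ.m * 12 + 18 +
      (searchTime δ L ((δ.size + 1) ^ L) + 1) ≤ N ^ (5 * L + 17) := by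
  set W := (δ.size + 1) ^ L
  set A := N ^ L with hA
  set E := N ^ 2 with hE
  have hA1 : 1 ≤ A := Nat.one_le_pow _ _ (by omega)
  have hE1 : 1 ≤ E := Nat.one_le_pow _ _ (by omega)
  have hLA : L ≤ A := (Nat.lt_pow_self hN).le
  have hW : W ≤ A ^ 2 := by
    rw [hA, ← pow_mul, mul_comm, pow_mul]
    exact Nat.pow_le_pow_left hs L
  have h1 := checkTime_le (δ := δ) hE1 hA1 hm (by omega) hLA hW
  have h2 : searchTime δ L W ≤ 416 * (N * A ^ 5 * E ^ 3) := by
    calc searchTime δ L W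
        ≤ (N + N) * (A ^ 2 * (203 * (A ^ 3 * E ^ 3)) + 4 * (A ^ 5 * E ^ 3)) +
          2 * (N * A ^ 5 * E ^ 3) := by
          unfold searchTime
          gcongr
          · omega
          · exact Nat.le_mul_of_pos_right _ (by positivity)
          · exact Nat.le_mul_of_pos_right _ (by positivity)
      _ = _ := by ring
  have h3 : L * (δ.m * 6 + 14) + δ.m * 12 + 19 ≤ 51 * (N * A ^ 5 * E ^ 3) := by
    calc L * (δ.m * 6 + 14) + δ.m * 12 + 19
        ≤ A * (E * 6 + 14 * E) + A * E * 12 + 19 * (A * E) := by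
          gcongr
          · omega
          · exact hm.trans (Nat.le_mul_of_pos_left _ (by positivity))
          · exact Nat.le_mul_of_pos_right _ (by positivity)
      _ = 51 * (1 * A ^ 1 * E ^ 1) := by ring
      _ ≤ _ := by gcongr <;> omega
  calc L * (δ.m * 6 + 14) + δ.m * 12 + 18 + (searchTime δ L W + 1)
      ≤ 2 ^ 10 * (N * A ^ 5 * E ^ 3) := by omega
    _ ≤ N ^ 10 * (N * A ^ 5 * E ^ 3) := by gcongr
    _ = _ := by rw [hA, hE]; ring

/-- The local search on a random access machine. -/
def localSearchProg : Program := .seq initProg searchProg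

theorem ends_localSearchProg (hl : IsEdgeList G l) {p q : ℕ} {ε : ℝ} (hp : 0 < p)
    (hε : ε = p / q) : Ends localSearchProg (inputState l p q) (max n 2 ^ (5 * (2 * q / p) + 17))
      fun s => IsLocalSearchResult G (2 / ε) (outputEdges l s) := by
  have hL : ∀ k : ℕ, (k : ℝ) ≤ 2 / ε ↔ k ≤ 2 * q / p := by
    intro k
    have hp' : (0 : ℝ) < p := by exact_mod_cast hp
    rw [Nat.le_div_iff_mul_le hp, hε, div_div_eq_mul_div, le_div_iff₀ hp']
    exact_mod_cast Iff.rfl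
  obtain ⟨s, t, he, ht, δ, hδ, hs, h2⟩ := ends_initProg (n := n) (l := l) (q := q) hp
  obtain ⟨s', t', he', ht', hr⟩ := ends_searchProg hδ hl hL hs h2
  have h1 := hl.two_mul_length_lt
  refine ⟨s', _, .seq he he', ?_, hr⟩
  have := time_le (δ := δ) (N := max n 2) (L := 2 * q / p) (le_max_right _ _)
    (hδ.n ▸ le_max_left _ _) (by rw [hδ.m]; omega) (by rw [hδ.size]; omega)
  rw [hδ.m] at this
  omega

end Search

end TriangleFree

open TriangleFree in
theorem theorem1 :
    -- every execution of the local search, whichever augmenting trails it chooses to flip,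
    -- makes at most `|V|` flips and can only return a `(1 - ε)`-approximate solution
    (∀ (V : Type*) [Fintype V] [DecidableEq V] (G : SimpleGraph V) (ε : ℝ), 0 < ε → ε ≤ 1 →
      (∀ (k : ℕ) (M : Finset (Sym2 V)), Run G (2 / ε) k M → k ≤ Fintype.card V) ∧
      (∀ M : Finset (Sym2 V), IsLocalSearchResult G (2 / ε) M →
        IsTwoMatching G M ∧
        ∀ OPT : Finset (Sym2 V), IsTwoMatching G OPT →
          (1 - ε) * (OPT.card : ℝ) ≤ (M.card : ℝ))) ∧
    -- one program, with `G` and `ε = p / q` as its input, carries out the local search in time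
    -- `n ^ O(1 / ε)`
    (∃ (A : Program) (C : ℝ),
      ∀ (n : ℕ) (G : SimpleGraph (Fin n)) (l : List (Fin n × Fin n)), IsEdgeList G l →
      ∀ (p q : ℕ) (ε : ℝ), 0 < p → p ≤ q → ε = (p : ℝ) / (q : ℝ) →
        ∃ (s : State) (t : ℕ),
          Exec A (inputState l p q) s t ∧
          (t : ℝ) ≤ ((max n 2 : ℕ) : ℝ) ^ (C / ε) ∧
          IsLocalSearchResult G (2 / ε) (outputEdges l s) ∧
          IsTwoMatching G (outputEdges l s) ∧
          ∀ OPT : Finset (Sym2 (Fin n)), IsTwoMatching G OPT →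
            (1 - ε) * (OPT.card : ℝ) ≤ ((outputEdges l s).card : ℝ)) := by
  refine ⟨fun V _ _ G ε hε _ => ⟨fun k M h => h.le_card, fun M h =>
    ⟨h.1.choose_spec.isTwoMatching.1, fun O hO => h.le_card hε hO⟩⟩, localSearchProg, 27, ?_⟩
  intro n G l hl p q ε hp hpq hε
  obtain ⟨s, t, he, ht, hr⟩ := ends_localSearchProg hl hp hε
  have hp' : (0 : ℝ) < p := by exact_mod_cast hp
  have hq' : (0 : ℝ) < q := by exact_mod_cast hp.trans_le hpq
  have hpq' : (p : ℝ) ≤ q := by exact_mod_cast hpq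
  have hε0 : 0 < ε := by rw [hε]; positivity
  refine ⟨s, t, he, ?_, hr, hr.1.choose_spec.isTwoMatching.1, fun O hO => hr.le_card hε0 hO⟩
  have hN : (1 : ℝ) ≤ ((max n 2 : ℕ) : ℝ) := by
    exact_mod_cast (by norm_num : 1 ≤ 2).trans (le_max_right n 2)
  -- Since `ε ≤ 1`, the exponent `5 * (2 / ε) + 17` is at most `27 / ε`.
  have h1 : (1 : ℝ) ≤ 1 / ε := by
    rw [hε, one_div_div, le_div_iff₀ hp', one_mul]
    exact hpq'
  have h2 : ((2 * q / p : ℕ) : ℝ) ≤ 2 / ε := by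
    refine Nat.cast_div_le.trans (le_of_eq ?_)
    rw [hε, div_div_eq_mul_div]
    push_cast
    rfl
  calc (t : ℝ) ≤ ((max n 2 : ℕ) : ℝ) ^ (5 * (2 * q / p) + 17) := by exact_mod_cast ht
    _ = ((max n 2 : ℕ) : ℝ) ^ ((5 * (2 * q / p) + 17 : ℕ) : ℝ) := (Real.rpow_natCast _ _).symm
    _ ≤ _ := by
      refine Real.rpow_le_rpow_of_exponent_le hN ?_
      push_cast at h2 ⊢
      have : 2 / ε = 2 * (1 / ε) := by ring
      have : 27 / ε = 27 * (1 / ε) := by ring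
      linarith
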